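/- A pipe dream of rank $m\ge 0$ fills the staircase whose row $i$ ($1\le i\le m$, counted from the top) has the $m+1-i$ left-justified tiles $(i,1),\dots,(i,m+1-i)$ with crossing tiles and bumping tiles, each tile $(i,m+1-i)$ being a bumping tile. From the top of each column $c=1,\dots,m$ a pipe enters; it moves down and to the left and leaves through the left boundary. In a crossing tile pipes go straight on; in a bumping tile the pipe coming from the top leaves to the left and the pipe coming from the right leaves through the bottom. The pipe dream is reduced if any two pipes cross at most once. Let $v$ be a word of length $m$ with distinct positive integer entries. Label the pipes from left to right along the top by the entries of $v$ in increasing order. A reduced pipe dream of $v$ is a reduced pipe dream of rank $m$ for which the labels along the left boundary, read from top to bottom, form $v$. A marked reduced pipe dream of $v$ is such a pipe dream together with a (possibly empty) set of marked bumping tiles, where a bumping tile in row $i$ may be marked only if it is traversed by two pipes that cross somewhere above row $i$. Let $\mathrm{MRPD}(v)$ be the set of these. Pipe $j$ of $P\in\mathrm{MRPD}(v)$ is removable if (i) in the column $C_j$ where it enters, all crossing tiles are traversed by pipe $j$ and no tile is marked; (ii) no tile directly above a crossing tile traversed by pipe $j$ is an unmarked bumping tile; (iii) pipe $j$ traverses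 no marked tile. Let $\mathrm{CMRPD}(v)$ be the set of those $P\in\mathrm{MRPD}(v)$ that are core, i.e. have no removable pipe. If pipe $j$ of $P$ is removable, define $\Phi_j(P)$ by deletion and merging: delete column $C_j$ and move all tiles to the right of it one column to the left. In each column $k$ to the left of $C_j$, pipe $j$ enters from the right, in some tile $(r,k)$, and traverses either only this tile, a crossing tile, or exactly two tiles, the unmarked bumping tiles $(r,k)$ and $(r+1,k)$. In the first case delete the tile $(r,k)$; in the second case delete the lower right half of $(r,k)$ and the upper left half of $(r+1,k)$, so that the remaining two halves merge to an unmarked bumping tile $(r,k)$. In both cases move everything in column $k$ below the deleted part up by one row. The result is a filling of rank $m-1$ for the word obtained from $v$ by deleting the entry $j$. For a permutation $w\in S_n$, written as the word $w(1)\cdots w(n)$, and $P\in\mathrm{MRPD}(w)$ with removable pipes $j_1,\dots,j_k$, let $$\Phi(P)=\Phi_{j_k}(\cdots\Phi_{j_2}(\Phi_{j_1}(P))\cdots),$$ regarded as a pipe dream of the word obtained from $w$ by deleting the entries $j_1,\dots,j_k$. Here the removable pipes are deleted in the order in which their labels occur in some arbitrary fixed ordering of $\{1,\dots,n\}$. **Theorem.**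 Let $w\in S_n$ be a permutation that avoids the pattern $1423$, i.e. there are no $a<b<c<d$ with $w(a)<w(c)<w(d)<w(b)$. Then, whatever ordering of $\{1,\dots,n\}$ is used, the map $$\Phi\colon \mathrm{MRPD}(w)\longrightarrow \bigsqcup_{v\le w}\mathrm{CMRPD}(v)$$ is (well defined and) a bijection, where $v$ runs over all subwords of $w$, including the empty one and $w$ itself. -/

import Mathlib

namespace PipeDream

/-- The three kinds of tiles: an (unmarked) bumping tile, a marked bumping tile, a crossing tile. -/
inductive Tile
  | bump
  | marked
  | cross

/-- A filling `P`, with `P i j` the tile in row `i` and column `j`; rows are counted from the top,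
columns from the left, and both counts start at `0`. A filling of the staircase of rank `m` is
extended by unmarked bumping tiles to all positions that lie outside of it. -/
abbrev Filling := ℕ → ℕ → Tile

/-- The side through which a pipe enters a tile. -/
inductive Side
  | top
  | right

/-- `Enters P c s i j`: in `P`, the pipe that enters from the top boundary in column `c` passes
through the tile `(i, j)`, which it enters from the side `s`. In a crossing tile pipes go straight
on; in a bumping tile (marked or not) the pipe that comes from the top leaves to the left, and the
pipe that comes from the right leaves through the bottom. -/
inductive Enters (P : Filling) (c : ℕ) : Side → ℕ → ℕ → Prop
  | start : Enters P c Side.top 0 c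
  | cross_down {i j : ℕ} : Enters P c Side.top i j → P i j = Tile.cross →
      Enters P c Side.top (i + 1) j
  | bump_left {i j : ℕ} : Enters P c Side.top i (j + 1) → P i (j + 1) ≠ Tile.cross →
      Enters P c Side.right i j
  | cross_left {i j : ℕ} : Enters P c Side.right i (j + 1) → P i (j + 1) = Tile.cross →
      Enters P c Side.right i j
  | bump_down {i j : ℕ} : Enters P c Side.right i j → P i j ≠ Tile.cross →
      Enters P c Side.top (i + 1) j

/-- The pipe that enters in column `c` passes through the tile `(i, j)`. -/
def Traverses (P : Filling) (c i j : ℕ) : Prop :=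
  Enters P c Side.top i j ∨ Enters P c Side.right i j

/-- The pipe that enters in column `c` leaves through the left boundary in row `i`. -/
def Exits (P : Filling) (c i : ℕ) : Prop :=
  (Enters P c Side.top i 0 ∧ P i 0 ≠ Tile.cross) ∨
    (Enters P c Side.right i 0 ∧ P i 0 = Tile.cross)

/-- The pipes that enter in columns `c` and `d` are the two pipes that meet in the tile `(i, j)`. -/
def Meet (P : Filling) (c d i j : ℕ) : Prop :=
  (Enters P c Side.top i j ∧ Enters P d Side.right i j) ∨
    (Enters P d Side.top i j ∧ Enters P c Side.right i j)

/-- The pipes that enter in columns `c` and `d` cross in the tile `(i, j)`. -/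
def CrossAt (P : Filling) (c d i j : ℕ) : Prop :=
  P i j = Tile.cross ∧ Meet P c d i j

/-- The pipes of a pipe dream of a word `v` are labelled from left to right by the entries of `v`
in increasing order. This is the column in which the pipe labelled `a` enters. -/
def entryCol (v : List ℕ) (a : ℕ) : ℕ := v.countP (fun b => decide (b < a))

/-- The marked reduced pipe dreams of a word `v` with distinct entries. The rank is the length `m`
of `v`: in the row with index `i` the staircase has the columns `0, …, m - 1 - i`. -/
structure IsMRPD (v : List ℕ) (P : Filling) : Prop where
  /-- The tiles on the southeast diagonal are unmarked bumping tiles, and so is the padding. -/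
  staircase : ∀ i j, v.length ≤ i + j + 1 → P i j = Tile.bump
  /-- The labels along the left boundary, from top to bottom, form the word `v`. -/
  word : ∀ (i : ℕ) (hi : i < v.length), Exits P (entryCol v v[i]) i
  /-- Any two pipes cross at most once. -/
  reduced : ∀ c < v.length, ∀ d < v.length, c ≠ d → ∀ i j i' j',
    CrossAt P c d i j → CrossAt P c d i' j' → i = i' ∧ j = j'
  /-- A bumping tile is marked only if the two pipes in it cross at some position above its row. -/
  marked : ∀ i j, P i j = Tile.marked → ∃ c < v.length, ∃ d < v.length, c ≠ d ∧
    Meet P c d i j ∧ ∃ i' < i, ∃ j', CrossAt P c d i' j'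

/-- The set of marked reduced pipe dreams of the word `v`. -/
def MRPD (v : List ℕ) : Set Filling := {P | IsMRPD v P}

/-- The pipe that enters in column `c` is removable. -/
structure RemovableCol (P : Filling) (c : ℕ) : Prop where
  /-- In the column where the pipe enters, it traverses all crossing tiles. -/
  entry_cross : ∀ i, P i c = Tile.cross → Traverses P c i c
  /-- In the column where the pipe enters, no tile is marked. -/
  entry_unmarked : ∀ i, P i c ≠ Tile.marked
  /-- No tile directly above a crossing tile of the pipe is an unmarked bumping tile. -/
  above_cross : ∀ i j, P (i + 1) j = Tile.cross → Traverses P c (i + 1) j → P i j ≠ Tile.bump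
  /-- The pipe traverses no marked tile. -/
  unmarked : ∀ i j, Traverses P c i j → P i j ≠ Tile.marked

/-- The pipe labelled `a` in the pipe dream `P` of the word `v` is removable. -/
def Removable (v : List ℕ) (P : Filling) (a : ℕ) : Prop :=
  a ∈ v ∧ RemovableCol P (entryCol v a)

/-- The set of core marked reduced pipe dreams of `v`: no pipe is removable. -/
def CMRPD (v : List ℕ) : Set Filling := {P | P ∈ MRPD v ∧ ∀ a, ¬ Removable v P a}

open Classical in
/-- Deletion of the (removable) pipe that enters in column `c`, followed by merging.
Column `c` is deleted and everything to the right of it moves one column to the left.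
In a column `j` to the left of column `c`, let `i₀` be the row in which the pipe enters the column
from the right. If `(i₀, j)` is a crossing tile, this tile is deleted and everything below it moves
up. If it is a bumping tile, the pipe occupies the lower right half of `(i₀, j)` and the upper left
half of the bumping tile `(i₀ + 1, j)`; these two halves are deleted, everything below moves up,
and the two halves that remain form an unmarked bumping tile in position `(i₀, j)`. -/
noncomputable def deleteCol (P : Filling) (c : ℕ) : Filling := fun i j =>
  if c ≤ j then P i (j + 1)
  else if Enters P c Side.right i j ∧ P i j ≠ Tile.cross then Tile.bump
  else if ∃ i₀ ≤ i, Enters P c Side.right i₀ j then P (i + 1) j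
  else P i j

/-- The map `Φ_a`: from a pipe dream of a word `v` (given as a pair `(v, P)`), delete the pipe with
label `a`. The result is a pair whose word is `v` without the entry `a`. -/
noncomputable def deletePipe (D : List ℕ × Filling) (a : ℕ) : List ℕ × Filling :=
  (D.1.erase a, deleteCol D.2 (entryCol D.1 a))

open Classical in
/-- The reduction map `Φ` on the pipe dreams `P` of the word `v`: all removable pipes `a₁, …, aₖ`
of `P` are deleted, one after the other. The list `order` contains the labels of all pipes and
prescribes in which order the removable ones among them are deleted. -/
noncomputable def reduction (order v : List ℕ) (P : Filling) : List ℕ × Filling :=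
  (order.filter (fun a => decide (Removable v P a))).foldl deletePipe (v, P)

/-- The one-line notation `w(1) w(2) ⋯ w(n)` of a permutation, with values in `{1, …, n}`. -/
def oneLine {n : ℕ} (w : Equiv.Perm (Fin n)) : List ℕ := List.ofFn (fun i => (w i : ℕ) + 1)

/-- The permutation avoids the pattern `1423`. -/
def Avoids1423 {n : ℕ} (w : Equiv.Perm (Fin n)) : Prop :=
  ¬ ∃ i j k l : Fin n, i < j ∧ j < k ∧ k < l ∧ w i < w k ∧ w k < w l ∧ w l < w j

/-- The disjoint union of the sets of core marked reduced pipe dreams of all subwords `v` of `w`,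
the empty subword included; a point of it is a pair `(v, Q)`. -/
def coresOfSubwords {n : ℕ} (w : Equiv.Perm (Fin n)) : Set (List ℕ × Filling) :=
  {D | D.1.Sublist (oneLine w) ∧ D.2 ∈ CMRPD D.1}

end PipeDream

/-!
The deletion of a removable pipe is inverted by an insertion. Given a filling `Q`, the column `c` in
which a new pipe enters and the row in which it leaves column `0`, the path of the new pipe is
determined from left to right: in each column, the pipe splits the tile above it in two if this is
an unmarked bumping tile, and gets a crossing tile of its own otherwise. The fillings that arise in
this way are those in which the pipe is removable, and neither deletion nor insertion affects the
removability of the other pipes. Therefore the order of the deletions does not matter, and `Φ` is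
injective because the entries that are missing in the word of `Φ(P)` are the labels of the removable
pipes of `P`.

For surjectivity it must be seen that an insertion does not create pipes that cross twice.
Being reduced is a local condition: in every crossing tile the pipe from the top starts to the left
of the pipe from the right. If the new pipe `c` violates this in the crossing with a pipe `d > c`,
choose the leftmost such crossing. The tile above it is a crossing or a marked tile, so that `d`
shares it with a pipe `f > d`, and some pipe `x < c` leaves its column higher up. The pipes leave in
the order `x, f, c, d`, which is the pattern `1423`.
-/

namespace PipeDream

/-! ### Pipes in a filling -/

section Pipes

variable {P : Filling} {c d i j k m : ℕ} {s : Side}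

/-- The pipe that enters in column `c` leaves the tile `(i, j)` through its left side. In column
`0` this is `Exits P c i`. -/
def LeavesLeft (P : Filling) (c i j : ℕ) : Prop :=
  (Enters P c Side.top i j ∧ P i j ≠ Tile.cross) ∨ (Enters P c Side.right i j ∧ P i j = Tile.cross)

/-- The staircase condition of `IsMRPD`: all tiles on the diagonal of the staircase of rank `m` and
outside of it are unmarked bumping tiles. -/
def Padded (m : ℕ) (P : Filling) : Prop := ∀ i j, m ≤ i + j + 1 → P i j = Tile.bump

theorem Tile.eq_bump {t : Tile} (hcross : t ≠ cross) (hmarked : t ≠ marked) : t = bump := by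
  cases t <;> simp_all only [ne_eq, not_true_eq_false]

theorem enters_right_iff : Enters P c Side.right i j ↔ LeavesLeft P c i (j + 1) := by
  constructor
  · rintro (_ | _ | ⟨h, hx⟩ | ⟨h, hx⟩ | _)
    · exact Or.inl ⟨h, hx⟩
    · exact Or.inr ⟨h, hx⟩
  · rintro (⟨h, hx⟩ | ⟨h, hx⟩)
    · exact .bump_left h hx
    · exact .cross_left h hx

theorem Enters.label_unique (h : Enters P c s i j) (h' : Enters P d s i j) : c = d := by
  induction h <;> cases h' <;> first | rfl | contradiction | solve_by_elim

theorem LeavesLeft.label_unique (h : LeavesLeft P c i j) (h' : LeavesLeft P d i j) : c = d := by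
  rcases h with ⟨h, hx⟩ | ⟨h, hx⟩ <;> rcases h' with ⟨h', hx'⟩ | ⟨h', hx'⟩
  · exact h.label_unique h'
  · exact absurd hx' hx
  · exact absurd hx hx'
  · exact h.label_unique h'

theorem Enters.col_le (h : Enters P c s i j) : j ≤ c := by
  induction h <;> omega

theorem Enters.col_lt (h : Enters P c Side.right i j) : j < c := by
  cases h with
  | bump_left h _ => exact h.col_le
  | cross_left h _ => exact h.col_le

theorem LeavesLeft.col_le (h : LeavesLeft P c i j) : j ≤ c :=
  h.elim (fun h => h.1.col_le) (fun h => h.1.col_le)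

theorem Traverses.enters_top (h : Traverses P c i c) : Enters P c Side.top i c :=
  h.resolve_right fun h => h.col_lt.false

theorem Enters.cross_above (h : Enters P c Side.top i c) (hk : k < i) : P k c = Tile.cross := by
  induction i with
  | zero => omega
  | succ i ih =>
    cases h with
    | cross_down h hx =>
      rcases Nat.lt_succ_iff_lt_or_eq.1 hk with hk | rfl
      exacts [ih h hk, hx]
    | bump_down h _ => exact absurd h.col_lt (lt_irrefl _)

theorem Padded.exists_enters_right (hP : Padded m P) (htop : ∀ j, ∃ c, Enters P c Side.top i j)
    (j : ℕ) : ∃ c, Enters P c Side.right i j := by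
  obtain ⟨k, hk⟩ : ∃ k, m ≤ j + k := ⟨m, by omega⟩
  induction k generalizing j with
  | zero =>
    obtain ⟨c, hc⟩ := htop (j + 1)
    exact ⟨c, .bump_left hc (by simp [hP i (j + 1) (by omega)])⟩
  | succ k ih =>
    by_cases hx : P i (j + 1) = Tile.cross
    · obtain ⟨c, hc⟩ := ih (j + 1) (by omega)
      exact ⟨c, .cross_left hc hx⟩
    · obtain ⟨c, hc⟩ := htop (j + 1)
      exact ⟨c, .bump_left hc hx⟩

theorem Padded.exists_enters_top (hP : Padded m P) (i j : ℕ) : ∃ c, Enters P c Side.top i j := by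
  induction i generalizing j with
  | zero => exact ⟨j, .start⟩
  | succ i ih =>
    by_cases hx : P i j = Tile.cross
    · obtain ⟨c, hc⟩ := ih j
      exact ⟨c, .cross_down hc hx⟩
    · obtain ⟨c, hc⟩ := hP.exists_enters_right ih j
      exact ⟨c, .bump_down hc hx⟩

theorem Padded.exists_enters (hP : Padded m P) (s : Side) (i j : ℕ) : ∃ c, Enters P c s i j := by
  cases s with
  | top => exact hP.exists_enters_top i j
  | right => exact hP.exists_enters_right (hP.exists_enters_top i) j

theorem Padded.exists_leavesLeft (hP : Padded m P) (i j : ℕ) : ∃ c, LeavesLeft P c i j := by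
  by_cases hx : P i j = Tile.cross
  · exact (hP.exists_enters Side.right i j).imp fun c hc => Or.inr ⟨hc, hx⟩
  · exact (hP.exists_enters Side.top i j).imp fun c hc => Or.inl ⟨hc, hx⟩

theorem Enters.add_lt (hP : Padded m P) (h : Enters P c s i j) (hc : c < m) :
    i + j < m ∧ (s = Side.right → i + j + 1 < m) := by
  induction h with
  | start => simp [hc]
  | @cross_down i j _ hx ih =>
    have : i + j + 1 < m := by
      by_contra hge
      simp [hP i j (by omega)] at hx
    exact ⟨by omega, by simp⟩
  | bump_left _ _ ih => exact ⟨by omega, fun _ => by omega⟩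
  | cross_left _ _ ih => exact ⟨by omega, fun _ => by have := ih.2 rfl; omega⟩
  | bump_down _ _ ih => exact ⟨by have := ih.2 rfl; omega, by simp⟩

theorem LeavesLeft.row_lt (hP : Padded m P) (h : LeavesLeft P c i j) (hc : c < m) : i < m := by
  rcases h with ⟨h, -⟩ | ⟨h, -⟩ <;>
  · have := (h.add_lt hP hc).1
    omega

theorem Enters.le_add (hP : Padded m P) (h : Enters P c s i j) (hc : m ≤ c) :
    m ≤ i + j + 1 ∧ (s = Side.top → m ≤ i + j) := by
  induction h with
  | start => exact ⟨by omega, fun _ => by omega⟩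
  | cross_down _ _ ih => exact ⟨by omega, fun _ => by have := ih.2 rfl; omega⟩
  | bump_left _ _ ih => exact ⟨by have := ih.2 rfl; omega, by simp⟩
  | @cross_left i j _ hx ih => simp [hP i (j + 1) (by omega)] at hx
  | bump_down _ _ ih => exact ⟨by omega, fun _ => by omega⟩

theorem Enters.lt_of_ne_bump (hP : Padded m P) (h : Enters P c s i j) (hx : P i j ≠ Tile.bump) :
    c < m := by
  by_contra hc
  exact hx (hP i j (h.le_add hP (by omega)).1)

theorem Padded.exists_leavesLeft_of_top (hP : Padded m P) (h : Enters P c Side.top i j) :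
    ∃ k, i ≤ k ∧ LeavesLeft P c k j ∧ ∀ r, i ≤ r → r ≤ k → Enters P c Side.top r j := by
  obtain ⟨n, hn⟩ : ∃ n, m ≤ i + n := ⟨m, by omega⟩
  induction n generalizing i with
  | zero =>
    refine ⟨i, le_rfl, Or.inl ⟨h, by simp [hP i j (by omega)]⟩, fun r hr hr' => ?_⟩
    rwa [le_antisymm hr' hr]
  | succ n ih =>
    by_cases hx : P i j = Tile.cross
    · obtain ⟨k, hk, hleft, hcol⟩ := ih (.cross_down h hx) (by omega)
      refine ⟨k, by omega, hleft, fun r hr hr' => ?_⟩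
      rcases hr.eq_or_lt with rfl | hr
      exacts [h, hcol r hr hr']
    · refine ⟨i, le_rfl, Or.inl ⟨h, hx⟩, fun r hr hr' => ?_⟩
      rwa [le_antisymm hr' hr]

theorem Padded.exists_leavesLeft_of_right (hP : Padded m P) (h : Enters P c Side.right i j) :
    ∃ k, i ≤ k ∧ LeavesLeft P c k j ∧ ∀ r, i < r → r ≤ k → Enters P c Side.top r j := by
  by_cases hx : P i j = Tile.cross
  · exact ⟨i, le_rfl, Or.inr ⟨h, hx⟩, fun r hr hr' => by omega⟩
  · obtain ⟨k, hk, hleft, hcol⟩ := hP.exists_leavesLeft_of_top (h.bump_down hx)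
    exact ⟨k, by omega, hleft, hcol⟩

theorem enters_or_leavesLeft (P : Filling) (i j : ℕ) :
    Enters P j Side.top i j ∨ ∃ k < i, LeavesLeft P j k j := by
  induction i with
  | zero => exact Or.inl .start
  | succ i ih =>
    rcases ih with h | ⟨k, hk, h⟩
    · by_cases hx : P i j = Tile.cross
      · exact Or.inl (.cross_down h hx)
      · exact Or.inr ⟨i, by omega, Or.inl ⟨h, hx⟩⟩
    · exact Or.inr ⟨k, by omega, h⟩

end Pipes

/-! ### Pipes along the diagonals -/

section Diagonals

variable {P : Filling} {c i i' j j' x y : ℕ} {s s' : Side}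

/-- The number, counted from the top left, of the edge through which a tile of row `i` is entered
from the given side, among the edges that enter tiles of its diagonal `j - i = const`. The pipes
visit the diagonals one after the other, from the top right to the bottom left, so these numbers
compare the positions of two pipes on the same diagonal. -/
def Side.rank : Side → ℕ → ℕ
  | top, i => 2 * i
  | right, i => 2 * i + 1

/-- The rank, on the next diagonal, of the edge through which a pipe leaves a tile of row `i` that
it enters from the given side: `2 * i + 1` if it leaves to the left, `2 * i + 2` if it leaves
through the bottom. -/
def Tile.exitRank : Tile → Side → ℕ → ℕ
  | cross, .top, i | bump, .right, i | marked, .right, i => 2 * i + 2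
  | cross, .right, i | bump, .top, i | marked, .top, i => 2 * i + 1

theorem Side.rank_inj : s.rank i = s'.rank i' ↔ s = s' ∧ i = i' := by
  cases s <;> cases s' <;> simp [Side.rank] <;> omega

theorem Enters.exists_prev (h : Enters P c s i j) (hlt : j < i + c) :
    ∃ s₁ i₁ j₁, Enters P c s₁ i₁ j₁ ∧ i + j₁ = i₁ + j + 1 ∧
      s.rank i = (P i₁ j₁).exitRank s₁ i₁ := by
  have exit_ne_cross : ∀ {t : Tile}, t ≠ Tile.cross → ∀ k,
      t.exitRank .top k = 2 * k + 1 ∧ t.exitRank .right k = 2 * k + 2 := by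
    rintro (_ | _ | _) ht k <;> simp_all [Tile.exitRank]
  cases h with
  | start => omega
  | cross_down h hx => exact ⟨_, _, _, h, by omega, by rw [hx]; rfl⟩
  | bump_left h hx => exact ⟨_, _, _, h, by omega, (exit_ne_cross hx _).1.symm⟩
  | cross_left h hx => exact ⟨_, _, _, h, by omega, by rw [hx]; rfl⟩
  | bump_down h hx => exact ⟨_, _, _, h, by omega, (exit_ne_cross hx _).2.symm⟩

theorem Enters.eq_of_diagonal (h : Enters P c s i j) (h' : Enters P c s' i' j')
    (hdiag : i + j' = i' + j) : s = s' ∧ i = i' ∧ j = j' := by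
  obtain ⟨n, hn⟩ : ∃ n, i + c = n + j := ⟨i + c - j, by have := h.col_le; omega⟩
  induction n generalizing s s' i j i' j' with
  | zero =>
    have hj := h.col_le
    have hj' := h'.col_le
    refine ⟨?_, by omega, by omega⟩
    cases s <;> cases s' <;> first | rfl | skip
    · have := h'.col_lt
      omega
    · have := h.col_lt
      omega
  | succ n ih =>
    obtain ⟨s₁, i₁, j₁, h₁, hd₁, hr₁⟩ := h.exists_prev (by omega)
    obtain ⟨s₂, i₂, j₂, h₂, hd₂, hr₂⟩ := h'.exists_prev (by omega)
    obtain ⟨rfl, rfl, rfl⟩ := ih h₁ h₂ (by omega) (by omega)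
    obtain ⟨rfl, rfl⟩ := Side.rank_inj.1 (hr₁.trans hr₂.symm)
    exact ⟨rfl, rfl, by omega⟩

theorem Enters.top_ne_right (h : Enters P x Side.top i j) (h' : Enters P y Side.right i j) :
    x ≠ y := by
  rintro rfl
  cases (h.eq_of_diagonal h' rfl).1

theorem Enters.row_mono (h : Enters P c s i j) (h' : Enters P c s' i' j')
    (hdiag : i + j' ≤ i' + j) : i ≤ i' := by
  obtain ⟨n, hn⟩ : ∃ n, i' + c = n + j' := ⟨i' + c - j', by have := h'.col_le; omega⟩
  induction n generalizing s' i' j' with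
  | zero =>
    have hj := h.col_le
    have hj' := h'.col_le
    omega
  | succ n ih =>
    rcases hdiag.eq_or_lt with heq | hlt
    · exact (h.eq_of_diagonal h' heq).2.1.le
    · obtain ⟨s₁, i₁, j₁, h₁, hd₁, hr₁⟩ := h'.exists_prev (by omega)
      have hi : i ≤ i₁ := ih h₁ (by omega) (by omega)
      have hi₁ : 2 * i₁ + 1 ≤ s'.rank i' := by
        rw [hr₁]
        cases P i₁ j₁ <;> cases s₁ <;> simp [Tile.exitRank]
      cases s' <;> simp only [Side.rank] at hi₁ <;> omega

theorem Enters.row_lt_of_top (h : Enters P c s i j) (h' : Enters P c Side.top i' j')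
    (hlt : i + j' < i' + j) : i < i' := by
  cases h' with
  | start =>
    have := h.col_le
    omega
  | cross_down h' _ => exact Nat.lt_succ_of_le (h.row_mono h' (by omega))
  | bump_down h' _ => exact Nat.lt_succ_of_le (h.row_mono h' (by omega))

theorem LeavesLeft.col_lt (h : LeavesLeft P c i j) (h' : Enters P c s' i' j')
    (hlt : i + j' < i' + j) : j' < j := by
  have of_prev {s₁ : Side} {i₁ j₁ : ℕ} (h₁ : Enters P c s₁ i₁ j₁) (hle : i + j₁ ≤ i₁ + j)
      (ih : i + j₁ < i₁ + j → j₁ < j) :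
      j₁ < j ∨ (j₁ = j ∧ (P i₁ j₁ = Tile.cross ↔ s₁ = Side.right)) := by
    rcases hle.lt_or_eq with hlt | heq
    · exact Or.inl (ih hlt)
    · rcases h with ⟨h, hx⟩ | ⟨h, hx⟩ <;> obtain ⟨rfl, rfl, rfl⟩ := h.eq_of_diagonal h₁ heq <;>
        simp [hx]
  induction h' with
  | start =>
    have := h.col_le
    omega
  | cross_down h₁ hx ih | bump_down h₁ hx ih =>
    rcases of_prev h₁ (by omega) ih with h | ⟨-, h⟩
    · exact h
    · simp [hx] at h
  | bump_left h₁ _ ih | cross_left h₁ _ ih =>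
    rcases of_prev h₁ (by omega) ih with h | ⟨h, -⟩ <;> omega

theorem LeavesLeft.row_unique (h : LeavesLeft P c i j) (h' : LeavesLeft P c i' j) : i = i' := by
  have hle {k k' : ℕ} (h : LeavesLeft P c k j) (h' : LeavesLeft P c k' j) : k' ≤ k := by
    by_contra! hlt
    rcases h' with ⟨h', -⟩ | ⟨h', -⟩ <;> exact (h.col_lt h' (by omega)).false
  exact le_antisymm (hle h' h) (hle h h')

end Diagonals

/-! ### The order of two pipes and their crossings -/

section Crossings

variable {P : Filling} {i i' j j' x y : ℕ} {s s' : Side}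

/-- The pipes `x` and `y` cross in a tile on a diagonal that a pipe visits before that of the tile
`(i, j)`. -/
def CrossedBefore (P : Filling) (x y i j : ℕ) : Prop :=
  ∃ i₀ j₀, CrossAt P x y i₀ j₀ ∧ i₀ + j < i + j₀

theorem CrossAt.symm (h : CrossAt P x y i j) : CrossAt P y x i j :=
  ⟨h.1, Or.symm h.2⟩

theorem CrossAt.exists_enters (h : CrossAt P x y i j) :
    (∃ s, Enters P x s i j) ∧ ∃ s, Enters P y s i j := by
  rcases h with ⟨-, ⟨hx, hy⟩ | ⟨hy, hx⟩⟩ <;> exact ⟨⟨_, hx⟩, ⟨_, hy⟩⟩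

theorem CrossAt.eq_of_diagonal (h : CrossAt P x y i j) (hx : Enters P x s i' j')
    (hdiag : i + j' = i' + j) : i = i' ∧ j = j' := by
  obtain ⟨⟨_, hx'⟩, -⟩ := h.exists_enters
  exact (hx'.eq_of_diagonal hx hdiag).2

theorem Tile.exitRank_bounds (t : Tile) (s : Side) (i : ℕ) :
    2 * i + 1 ≤ t.exitRank s i ∧ t.exitRank s i ≤ 2 * i + 2 := by
  cases t <;> cases s <;> simp [Tile.exitRank]

/-- The order of two pipes changes from one diagonal to the next exactly where they cross. -/
theorem Enters.exists_prev_pair (hx : Enters P x s i j) (hy : Enters P y s' i' j')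
    (hdiag : i + j' = i' + j) (hxy : x ≠ y) (hltx : j < i + x) (hlty : j' < i' + y) :
    ∃ s₁ i₁ j₁ s₂ i₂ j₂, Enters P x s₁ i₁ j₁ ∧ Enters P y s₂ i₂ j₂ ∧
      i + j₁ = i₁ + j + 1 ∧ i₁ + j₂ = i₂ + j₁ ∧
      ((s.rank i < s'.rank i' ↔ s₁.rank i₁ < s₂.rank i₂) ↔ ¬ CrossAt P x y i₁ j₁) := by
  obtain ⟨s₁, i₁, j₁, h₁, hd₁, hr₁⟩ := hx.exists_prev hltx
  obtain ⟨s₂, i₂, j₂, h₂, hd₂, hr₂⟩ := hy.exists_prev hlty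
  refine ⟨s₁, i₁, j₁, s₂, i₂, j₂, h₁, h₂, hd₁, by omega, ?_⟩
  rw [hr₁, hr₂]
  by_cases hi : i₁ = i₂
  · subst hi
    obtain rfl : j₁ = j₂ := by omega
    have hs : s₁ ≠ s₂ := by
      rintro rfl
      exact hxy (h₁.label_unique h₂)
    have hmeet : Meet P x y i₁ j₁ := by
      cases s₁ <;> cases s₂ <;>
        first | contradiction | exact Or.inl ⟨h₁, h₂⟩ | exact Or.inr ⟨h₂, h₁⟩
    simp only [CrossAt, hmeet, and_true]
    cases P i₁ j₁ <;> cases s₁ <;> cases s₂ <;> simp [Tile.exitRank, Side.rank] at hs ⊢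
  · have hcross : ¬ CrossAt P x y i₁ j₁ := fun hc =>
      hi (hc.symm.eq_of_diagonal h₂ (by omega)).1
    have := (P i₁ j₁).exitRank_bounds s₁ i₁
    have := (P i₂ j₂).exitRank_bounds s₂ i₂
    simp only [hcross, not_false_eq_true, iff_true]
    cases s₁ <;> cases s₂ <;> simp only [Side.rank] <;> omega

theorem Enters.crossedBefore (hx : Enters P x s i j) (hy : Enters P y s' i' j')
    (hdiag : i + j' = i' + j) (hyx : y < x) (hrank : s.rank i < s'.rank i') :
    CrossedBefore P x y i j := by
  obtain ⟨n, hn⟩ : ∃ n, i' + y = n + j' := ⟨i' + y - j', by have := hy.col_le; omega⟩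
  induction n generalizing s s' i j i' j' with
  | zero =>
    have hcol := hy.col_le
    cases s' with
    | top => simp only [Side.rank] at hrank; omega
    | right => have := hy.col_lt; omega
  | succ n ih =>
    obtain ⟨s₁, i₁, j₁, s₂, i₂, j₂, h₁, h₂, hd₁, hd₂, hflip⟩ :=
      hx.exists_prev_pair hy hdiag hyx.ne' (by omega) (by omega)
    by_cases hc : CrossAt P x y i₁ j₁
    · exact ⟨i₁, j₁, hc, by omega⟩
    · obtain ⟨i₀, j₀, hc₀, hlt⟩ := ih h₁ h₂ hd₂ ((hflip.2 hc).1 hrank) (by omega)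
      exact ⟨i₀, j₀, hc₀, by omega⟩

/-- Two pipes can only cross in such a way that afterwards the pipe from the right is below the
other one, and then they do not cross again. -/
theorem CrossedBefore.rank_lt
    (hP : ∀ ⦃i j x y⦄, Enters P x Side.top i j → Enters P y Side.right i j →
      P i j = Tile.cross → x < y)
    (hc : CrossedBefore P x y i j) (hx : Enters P x s i j) (hy : Enters P y s' i' j')
    (hdiag : i + j' = i' + j) (hyx : y < x) : s.rank i < s'.rank i' := by
  obtain ⟨n, hn⟩ : ∃ n, i' + y = n + j' := ⟨i' + y - j', by have := hy.col_le; omega⟩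
  induction n generalizing s s' i j i' j' with
  | zero =>
    obtain ⟨i₀, j₀, hc, hlt⟩ := hc
    obtain ⟨-, _, hy₀⟩ := hc.exists_enters
    have := hy₀.col_le
    omega
  | succ n ih =>
    obtain ⟨s₁, i₁, j₁, s₂, i₂, j₂, h₁, h₂, hd₁, hd₂, hflip⟩ :=
      hx.exists_prev_pair hy hdiag hyx.ne' (by omega) (by omega)
    have hside (hc₁ : CrossAt P x y i₁ j₁) : ¬ s₁.rank i₁ < s₂.rank i₂ := by
      rcases hc₁ with ⟨hcross, ⟨htop, hright⟩ | ⟨htop, hright⟩⟩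
      · exact absurd (hP htop hright hcross) hyx.asymm
      · obtain ⟨rfl, rfl, rfl⟩ := htop.eq_of_diagonal h₂ hd₂
        obtain ⟨rfl, -⟩ := hright.eq_of_diagonal h₁ rfl
        simp [Side.rank]
    obtain ⟨i₀, j₀, hc₀, hlt⟩ := hc
    rcases (show i₀ + j₁ ≤ i₁ + j₀ by omega).eq_or_lt with heq | hlt
    · obtain ⟨rfl, rfl⟩ := hc₀.eq_of_diagonal h₁ heq
      by_contra hrank
      exact hflip.1 (iff_of_false hrank (hside hc₀)) hc₀
    · have hrank := ih ⟨i₀, j₀, hc₀, hlt⟩ h₁ h₂ hd₂ (by omega)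
      exact (hflip.2 fun hc₁ => hside hc₁ hrank).2 hrank

end Crossings

/-! ### A local description of marked reduced pipe dreams -/

section LocallyValid

variable {P : Filling} {i j x y : ℕ} {v : List ℕ}

/-- The local form, at the tile `(i, j)`, of the conditions `reduced` and `marked` of `IsMRPD`: in
a crossing tile, the pipe from the top starts to the left of the pipe from the right, and in a
marked tile it starts to the right of it. -/
def ValidAt (P : Filling) (i j : ℕ) : Prop :=
  ∀ x y, Enters P x Side.top i j → Enters P y Side.right i j →
    (P i j = Tile.cross → x < y) ∧ (P i j = Tile.marked → y < x)

/-- All tiles satisfy the local form of the conditions `reduced` and `marked` of `IsMRPD`. -/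
def LocallyValid (P : Filling) : Prop := ∀ i j, ValidAt P i j

/-- The labels along the left boundary form the word `v`. -/
def HasWord (v : List ℕ) (P : Filling) : Prop :=
  ∀ (i : ℕ) (hi : i < v.length), Exits P (entryCol v v[i]) i

theorem IsMRPD.lt_of_cross (h : IsMRPD v P) (hx : Enters P x Side.top i j)
    (hy : Enters P y Side.right i j) (hcross : P i j = Tile.cross) : x < y := by
  have hpad : Padded v.length P := h.staircase
  have hne : P i j ≠ Tile.bump := by simp [hcross]
  by_contra! hle
  obtain ⟨i₀, j₀, hc, hlt⟩ : CrossedBefore P x y i j :=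
    hx.crossedBefore hy rfl (hle.lt_of_ne (hx.top_ne_right hy).symm) (by simp [Side.rank])
  have := h.reduced x (hx.lt_of_ne_bump hpad hne) y (hy.lt_of_ne_bump hpad hne)
    (hx.top_ne_right hy) i j i₀ j₀ ⟨hcross, Or.inl ⟨hx, hy⟩⟩ hc
  omega

theorem IsMRPD.lt_of_marked (h : IsMRPD v P) (hx : Enters P x Side.top i j)
    (hy : Enters P y Side.right i j) (hmarked : P i j = Tile.marked) : y < x := by
  obtain ⟨c, -, d, -, -, hmeet, i', hi', j', hc⟩ := h.marked i j hmarked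
  have hc' : CrossAt P y x i' j' := by
    rcases hmeet with ⟨hc', hd'⟩ | ⟨hd', hc'⟩
    · rw [hx.label_unique hc', hy.label_unique hd']
      exact hc.symm
    · rwa [hx.label_unique hd', hy.label_unique hc']
  have hbefore : CrossedBefore P y x i j := by
    refine ⟨i', j', hc', ?_⟩
    obtain ⟨⟨_, hy'⟩, -⟩ := hc'.exists_enters
    by_contra! hle
    exact hi'.not_ge (hy.row_mono hy' hle)
  by_contra! hle
  have := hbefore.rank_lt (fun _ _ _ _ => h.lt_of_cross) hy hx rfl
    (hle.lt_of_ne (hx.top_ne_right hy))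
  simp [Side.rank] at this

theorem IsMRPD.locallyValid (h : IsMRPD v P) : LocallyValid P :=
  fun _ _ _ _ hx hy => ⟨h.lt_of_cross hx hy, h.lt_of_marked hx hy⟩

theorem LocallyValid.not_crossedBefore (h : LocallyValid P) (hyx : y < x)
    (hc : CrossAt P x y i j) : ¬ CrossedBefore P x y i j := by
  intro hbefore
  rcases hc with ⟨hcross, ⟨hx, hy⟩ | ⟨hy, hx⟩⟩
  · exact hyx.asymm ((h i j x y hx hy).1 hcross)
  · have := hbefore.rank_lt (fun i j x y hx hy => (h i j x y hx hy).1) hx hy rfl hyx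
    simp [Side.rank] at this

theorem LocallyValid.crossAt_unique (h : LocallyValid P) (hyx : y < x) {i' j' : ℕ}
    (hc : CrossAt P x y i j) (hc' : CrossAt P x y i' j') : i = i' ∧ j = j' := by
  obtain ⟨⟨_, hx'⟩, -⟩ := hc'.exists_enters
  refine hc.eq_of_diagonal hx' (le_antisymm ?_ ?_) <;> by_contra! hlt
  · exact h.not_crossedBefore hyx hc ⟨i', j', hc', hlt⟩
  · exact h.not_crossedBefore hyx hc' ⟨i, j, hc, hlt⟩

theorem LocallyValid.exists_crossAt_above (h : LocallyValid P) (hx : Enters P x Side.top i j)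
    (hy : Enters P y Side.right i j) (hmarked : P i j = Tile.marked) :
    ∃ i' < i, ∃ j', CrossAt P x y i' j' := by
  obtain ⟨i', j', hc, hlt⟩ : CrossedBefore P x y i j :=
    hx.crossedBefore hy rfl ((h i j x y hx hy).2 hmarked) (by simp [Side.rank])
  obtain ⟨⟨_, hx'⟩, -⟩ := hc.exists_enters
  exact ⟨i', hx'.row_lt_of_top hx hlt, j', hc⟩

theorem LocallyValid.isMRPD (h : LocallyValid P) (hpad : Padded v.length P) (hword : HasWord v P) :
    IsMRPD v P where
  staircase := hpad
  word := hword
  reduced c _ d _ hcd i j i' j' hc hc' := by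
    rcases hcd.lt_or_gt with hlt | hlt
    · exact h.crossAt_unique hlt hc.symm hc'.symm
    · exact h.crossAt_unique hlt hc hc'
  marked i j hmarked := by
    have hne : P i j ≠ Tile.bump := by simp [hmarked]
    obtain ⟨x, hx⟩ := hpad.exists_enters Side.top i j
    obtain ⟨y, hy⟩ := hpad.exists_enters Side.right i j
    exact ⟨x, hx.lt_of_ne_bump hpad hne, y, hy.lt_of_ne_bump hpad hne, hx.top_ne_right hy,
      Or.inl ⟨hx, hy⟩, h.exists_crossAt_above hx hy hmarked⟩

theorem isMRPD_iff : IsMRPD v P ↔ Padded v.length P ∧ LocallyValid P ∧ HasWord v P :=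
  ⟨fun h => ⟨h.staircase, h.locallyValid, h.word⟩, fun ⟨hpad, h, hword⟩ => h.isMRPD hpad hword⟩

end LocallyValid

/-! ### Insertion of a removable pipe -/

/-- The increasing enumeration of the natural numbers other than `c`. -/
def skip (c d : ℕ) : ℕ := if d < c then d else d + 1

section Skip

variable {c d x y : ℕ}

theorem skip_of_lt (h : d < c) : skip c d = d := if_pos h

theorem skip_of_le (h : c ≤ d) : skip c d = d + 1 := if_neg h.not_gt

theorem skip_lt_skip : skip c x < skip c y ↔ x < y := by
  unfold skip
  split_ifs <;> omega

theorem skip_injective (c : ℕ) : Function.Injective (skip c) := by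
  intro x y
  unfold skip
  split_ifs <;> omega

theorem exists_skip_of_ne (h : d ≠ c) : ∃ x, skip c x = d := by
  rcases h.lt_or_gt with h | h
  · exact ⟨d, skip_of_lt h⟩
  · exact ⟨d - 1, by rw [skip_of_le (by omega)]; omega⟩

end Skip

section DeleteCol

variable {P : Filling} {c i j r : ℕ}

theorem deleteCol_of_le (hj : c ≤ j) : deleteCol P c i j = P i (j + 1) := if_pos hj

open Classical in
theorem deleteCol_of_lt (hj : j < c) (hr : LeavesLeft P c r (j + 1)) :
    deleteCol P c i j =
      if i = r ∧ P i j ≠ Tile.cross then Tile.bump else if r ≤ i then P (i + 1) j else P i j := by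
  have hrow (k : ℕ) : Enters P c Side.right k j ↔ k = r := by
    rw [enters_right_iff]
    exact ⟨fun hk => hk.row_unique hr, fun hk => hk ▸ hr⟩
  simp only [deleteCol, if_neg hj.not_ge, hrow, exists_eq_right]

end DeleteCol

/-- `P` arises from `Q` by the insertion of a removable pipe that enters in column `c` and leaves
column `j` in row `e j`: the inverse of `deleteCol`. In each column `j < c` the new pipe either
gets a crossing tile of its own, or it runs through the two halves of an unmarked bumping tile of
`Q`, which is thereby split into two. The first case requires that this tile is not placed below
an unmarked bumping tile. -/
structure IsInsertion (Q P : Filling) (c : ℕ) (e : ℕ → ℕ) : Prop where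
  right : ∀ i j, c ≤ j → P i (j + 1) = Q i j
  entry : ∀ i, P i c = if i < e c then Tile.cross else Tile.bump
  left : ∀ i j, j < c → P (skip (e j) i) j = Q i j
  step : ∀ j < c,
    (e j = e (j + 1) ∧ P (e j) j = Tile.cross ∧ ∀ i, i + 1 = e j → Q i j ≠ Tile.bump) ∨
    (e j = e (j + 1) + 1 ∧ P (e j) j = Tile.bump ∧ Q (e (j + 1)) j = Tile.bump)

/-- The row in `P` of the edge of `Q` through which the tile `(i, j)` with `j < c` is entered from
the given side, where `IsInsertion Q P c e`. -/
def Side.insertedRow (e : ℕ → ℕ) (i j : ℕ) : Side → ℕ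
  | top => skip (e j) i
  | right => skip (e (j + 1)) i

/-- Row `k` of `Q` and row `i` of `P` have the same tile in the columns `l` and `skip c l`, and
the same pipes pass through it, up to relabelling by `skip c`. -/
structure TileMatch (Q P : Filling) (c l k i : ℕ) : Prop where
  tile : P i (skip c l) = Q k l
  enters_iff : ∀ {d s}, Enters P (skip c d) s i (skip c l) ↔ Enters Q d s k l

namespace IsInsertion

variable {Q P : Filling} {c d i j k l m : ℕ} {e : ℕ → ℕ} {s : Side}

theorem exitRow_le (h : IsInsertion Q P c e) (hj : j < c) :
    e (j + 1) ≤ e j ∧ e j ≤ e (j + 1) + 1 := by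
  rcases h.step j hj with ⟨he, -⟩ | ⟨he, -⟩ <;> omega

theorem above (h : IsInsertion Q P c e) (hj : j < c) (hi : i < e j) : P i j = Q i j := by
  rw [← h.left i j hj, skip_of_lt hi]

theorem below (h : IsInsertion Q P c e) (hj : j < c) (hi : e (j + 1) ≤ i) :
    P (i + 1) j = Q i j := by
  rcases Nat.lt_or_ge i (e j) with hlt | hge
  · rcases h.step j hj with ⟨he, -⟩ | ⟨he, hP, hQ⟩
    · omega
    · obtain rfl : i = e (j + 1) := by omega
      rw [← he, hP, hQ]
  · rw [← h.left i j hj, skip_of_le hge]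

theorem entry_cross (h : IsInsertion Q P c e) (hi : i < e c) : P i c = Tile.cross := by
  rw [h.entry, if_pos hi]

theorem entry_bump (h : IsInsertion Q P c e) (hi : e c ≤ i) : P i c = Tile.bump := by
  rw [h.entry, if_neg hi.not_gt]

theorem enters_top_skip (h : IsInsertion Q P c e) (hj : j < c) (hd : Enters P d Side.top i j)
    (hi : i ≤ e j) (he : i = e j → e j = e (j + 1)) : Enters P d Side.top (skip (e j) i) j := by
  rcases hi.lt_or_eq with hlt | heq
  · rwa [skip_of_lt hlt]
  · rw [skip_of_le heq.ge]
    rcases h.step j hj with ⟨-, hx, -⟩ | ⟨he', -⟩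
    · exact hd.cross_down (by rwa [heq])
    · have := he heq
      omega

theorem enters_top_of_cross (h : IsInsertion Q P c e) (hj : j < c)
    (hd : Enters P d Side.top (skip (e j) i) j) (hx : Q i j = Tile.cross) :
    Enters P d Side.top (skip (e j) (i + 1)) j := by
  have hd' := hd.cross_down (by rwa [h.left i j hj])
  rcases Nat.lt_or_ge i (e j) with hi | hi
  · rw [skip_of_lt hi] at hd'
    refine h.enters_top_skip hj hd' hi fun heq => ?_
    rcases h.step j hj with ⟨he, -⟩ | ⟨he, -, hQ⟩
    · exact he
    · rw [show e (j + 1) = i by omega, hx] at hQ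
      cases hQ
  · rw [skip_of_le hi] at hd'
    rwa [skip_of_le (by omega)]

theorem enters_top_of_bump (h : IsInsertion Q P c e) (hj : j < c)
    (hd : Enters P d Side.right (skip (e (j + 1)) i) j) (hx : Q i j ≠ Tile.cross) :
    Enters P d Side.top (skip (e j) (i + 1)) j := by
  have hle := h.exitRow_le hj
  rcases Nat.lt_or_ge i (e (j + 1)) with hi | hi
  · rw [skip_of_lt hi] at hd
    exact h.enters_top_skip hj (hd.bump_down (by rwa [h.above hj (by omega)])) (by omega)
      (by omega)
  · rw [skip_of_le hi] at hd
    rw [skip_of_le (by omega)]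
    exact hd.bump_down (by rwa [h.below hj hi])

theorem leavesLeft_of_bump (h : IsInsertion Q P c e) (hj : j < c)
    (hd : Enters P d Side.top (skip (e j) i) j) (hx : Q i j ≠ Tile.cross) :
    LeavesLeft P d (skip (e j) i) j :=
  Or.inl ⟨hd, by rwa [h.left i j hj]⟩

theorem leavesLeft_of_cross (h : IsInsertion Q P c e) (hj : j < c)
    (hd : Enters P d Side.right (skip (e (j + 1)) i) j) (hx : Q i j = Tile.cross) :
    LeavesLeft P d (skip (e j) i) j := by
  suffices skip (e j) i = skip (e (j + 1)) i by
    exact Or.inr ⟨by rwa [this], by rwa [h.left i j hj]⟩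
  rcases h.step j hj with ⟨he, -⟩ | ⟨he, -, hQ⟩
  · rw [he]
  · have hne : i ≠ e (j + 1) := by
      rintro rfl
      rw [hx] at hQ
      cases hQ
    unfold skip
    split_ifs <;> omega

theorem leavesLeft_entry (h : IsInsertion Q P c e) (hd : LeavesLeft P d i (c + 1)) :
    LeavesLeft P d (skip (e c) i) c := by
  rw [← enters_right_iff] at hd
  rcases Nat.lt_or_ge i (e c) with hi | hi
  · rw [skip_of_lt hi]
    exact Or.inr ⟨hd, h.entry_cross hi⟩
  · rw [skip_of_le hi]
    refine Or.inl ⟨hd.bump_down ?_, ?_⟩ <;> rw [h.entry_bump (by omega)] <;> simp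

theorem enters_succ (h : IsInsertion Q P c e) (hd : Enters Q d s i j) (hj : c ≤ j) :
    Enters P (skip c d) s i (j + 1) := by
  induction hd with
  | start => exact skip_of_le hj ▸ .start
  | cross_down _ hx ih => exact (ih hj).cross_down (by rwa [h.right _ _ hj])
  | bump_left _ hx ih => exact (ih (by omega)).bump_left (by rwa [h.right _ _ (by omega)])
  | cross_left _ hx ih => exact (ih (by omega)).cross_left (by rwa [h.right _ _ (by omega)])
  | bump_down _ hx ih => exact (ih hj).bump_down (by rwa [h.right _ _ hj])

theorem leavesLeft_succ (h : IsInsertion Q P c e) (hd : LeavesLeft Q d i j) (hj : c ≤ j) :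
    LeavesLeft P (skip c d) i (j + 1) := by
  rw [LeavesLeft, h.right i j hj]
  exact hd.imp (And.imp_left (h.enters_succ · hj)) (And.imp_left (h.enters_succ · hj))

theorem enters_insertedRow (h : IsInsertion Q P c e) (hd : Enters Q d s i j) (hj : j < c) :
    Enters P (skip c d) s (s.insertedRow e i j) j := by
  induction hd with
  | start =>
    rw [skip_of_lt hj]
    exact h.enters_top_skip hj .start (Nat.zero_le _) fun he => by
      have := (h.exitRow_le hj).1
      omega
  | cross_down _ hx ih => exact h.enters_top_of_cross hj (ih hj) hx
  | bump_down _ hx ih => exact h.enters_top_of_bump hj (ih hj) hx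
  | bump_left hd hx ih =>
    refine enters_right_iff.2 ?_
    rcases (Nat.succ_le_of_lt hj).lt_or_eq with hlt | rfl
    · exact h.leavesLeft_of_bump hlt (ih hlt) hx
    · exact h.leavesLeft_entry (h.leavesLeft_succ (Or.inl ⟨hd, hx⟩) le_rfl)
  | cross_left hd hx ih =>
    refine enters_right_iff.2 ?_
    rcases (Nat.succ_le_of_lt hj).lt_or_eq with hlt | rfl
    · exact h.leavesLeft_of_cross hlt (ih hlt) hx
    · exact h.leavesLeft_entry (h.leavesLeft_succ (Or.inr ⟨hd, hx⟩) le_rfl)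

theorem leavesLeft_skip (h : IsInsertion Q P c e) (hd : LeavesLeft Q d i j) (hj : j ≤ c) :
    LeavesLeft P (skip c d) (skip (e j) i) j := by
  rcases hj.lt_or_eq with hlt | rfl
  · rcases hd with ⟨hd, hx⟩ | ⟨hd, hx⟩
    · exact h.leavesLeft_of_bump hlt (h.enters_insertedRow hd hlt) hx
    · exact h.leavesLeft_of_cross hlt (h.enters_insertedRow hd hlt) hx
  · exact h.leavesLeft_entry (h.leavesLeft_succ hd le_rfl)

theorem exits_iff (h : IsInsertion Q P c e) (hQ : Padded m Q) :
    Exits P (skip c d) (skip (e 0) i) ↔ Exits Q d i := by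
  refine ⟨fun hd => ?_, fun hd => h.leavesLeft_skip hd (Nat.zero_le c)⟩
  obtain ⟨x, hx⟩ := hQ.exists_leavesLeft i 0
  have hdx := (h.leavesLeft_skip hx (Nat.zero_le c)).label_unique hd
  rwa [← skip_injective c hdx]

theorem enters_entry (h : IsInsertion Q P c e) (hi : i ≤ e c) : Enters P c Side.top i c := by
  induction i with
  | zero => exact .start
  | succ i ih => exact (ih (by omega)).cross_down (h.entry_cross (by omega))

theorem leavesLeft (h : IsInsertion Q P c e) (hj : j ≤ c) : LeavesLeft P c (e j) j := by
  induction hj using Nat.decreasingInduction with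
  | self => exact Or.inl ⟨h.enters_entry le_rfl, by simp [h.entry_bump le_rfl]⟩
  | of_succ j hj ih =>
    rw [← enters_right_iff] at ih
    rcases h.step j hj with ⟨he, hx, -⟩ | ⟨he, hP, hQ⟩
    · exact Or.inr ⟨by rwa [he], hx⟩
    · have hbump : P (e (j + 1)) j = Tile.bump := by rw [h.above hj (by omega), hQ]
      refine Or.inl ⟨?_, by simp [hP]⟩
      rw [he]
      exact ih.bump_down (by simp [hbump])

protected theorem enters_right_iff (h : IsInsertion Q P c e) (hj : j < c) :
    Enters P c Side.right i j ↔ i = e (j + 1) := by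
  rw [enters_right_iff]
  refine ⟨fun hi => hi.row_unique (h.leavesLeft hj), ?_⟩
  rintro rfl
  exact h.leavesLeft hj

theorem deleteCol_eq (h : IsInsertion Q P c e) : deleteCol P c = Q := by
  funext i j
  rcases Nat.lt_or_ge j c with hj | hj
  · have hle := h.exitRow_le hj
    rw [deleteCol_of_lt hj (h.leavesLeft hj)]
    split_ifs with hsplit hbelow
    · obtain ⟨rfl, hx⟩ := hsplit
      rcases h.step j hj with ⟨he, hcross, -⟩ | ⟨-, -, hQ⟩
      · exact absurd (he ▸ hcross) hx
      · exact hQ.symm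
    · exact h.below hj hbelow
    · exact h.above hj (by omega)
  · rw [deleteCol_of_le hj, h.right i j hj]

theorem rows_unique {P' : Filling} {e' : ℕ → ℕ} (h : IsInsertion Q P c e)
    (h' : IsInsertion Q P' c e') (h0 : e 0 = e' 0) (hj : j ≤ c) : e j = e' j := by
  induction j with
  | zero => exact h0
  | succ j ih =>
    have ih := ih (by omega)
    rcases h.step j hj with ⟨he, -, hne⟩ | ⟨he, -, hQ⟩ <;>
      rcases h'.step j hj with ⟨he', -, hne'⟩ | ⟨he', -, hQ'⟩
    · omega
    · exact absurd hQ' (hne _ (by omega))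
    · exact absurd hQ (hne' _ (by omega))
    · omega

theorem unique {P' : Filling} {e' : ℕ → ℕ} (h : IsInsertion Q P c e)
    (h' : IsInsertion Q P' c e') (h0 : e 0 = e' 0) : P = P' := by
  have he {j : ℕ} (hj : j ≤ c) : e j = e' j := h.rows_unique h' h0 hj
  funext i j
  rcases lt_trichotomy j c with hj | rfl | hj
  · rcases eq_or_ne i (e j) with rfl | hi
    · have := he hj.le
      have : e (j + 1) = e' (j + 1) := he hj
      rcases h.step j hj with ⟨_, hP, -⟩ | ⟨_, hP, -⟩ <;>
        rcases h'.step j hj with ⟨_, hP', -⟩ | ⟨_, hP', -⟩ <;>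
        first | omega | rw [hP, he hj.le, hP']
    · obtain ⟨k, rfl⟩ := exists_skip_of_ne hi
      rw [h.left k j hj, he hj.le, h'.left k j hj]
  · rw [h.entry, h'.entry, he le_rfl]
  · obtain ⟨l, rfl⟩ := Nat.exists_eq_add_of_lt hj
    rw [h.right _ _ (by omega), h'.right _ _ (by omega)]

theorem tileMatch_right (h : IsInsertion Q P c e) (hQ : Padded m Q) (hl : c ≤ l) (i : ℕ) :
    TileMatch Q P c l i i := by
  constructor <;> rw [skip_of_le hl]
  · exact h.right i l hl
  · refine fun {d s} => ⟨fun hd => ?_, fun hd => h.enters_succ hd hl⟩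
    obtain ⟨x, hx⟩ := hQ.exists_enters s i l
    rwa [← skip_injective c ((h.enters_succ hx hl).label_unique hd)]

theorem enters_insertedRow_iff (h : IsInsertion Q P c e) (hQ : Padded m Q) (hj : j < c) :
    Enters P (skip c d) s (s.insertedRow e i j) j ↔ Enters Q d s i j := by
  refine ⟨fun hd => ?_, fun hd => h.enters_insertedRow hd hj⟩
  obtain ⟨x, hx⟩ := hQ.exists_enters s i j
  rwa [← skip_injective c ((h.enters_insertedRow hx hj).label_unique hd)]

theorem tileMatch_above (h : IsInsertion Q P c e) (hQ : Padded m Q) (hl : l < c)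
    (hi : i < e (l + 1)) : TileMatch Q P c l i i := by
  have hle := h.exitRow_le hl
  constructor <;> rw [skip_of_lt hl]
  · exact h.above hl (by omega)
  · intro d s
    rw [← h.enters_insertedRow_iff hQ hl]
    cases s <;> rw [Side.insertedRow, skip_of_lt (d := i) (by omega)]

theorem tileMatch_below (h : IsInsertion Q P c e) (hQ : Padded m Q) (hl : l < c)
    (hi : e l ≤ i) : TileMatch Q P c l i (i + 1) := by
  have hle := h.exitRow_le hl
  constructor <;> rw [skip_of_lt hl]
  · exact h.below hl (by omega)
  · intro d s
    rw [← h.enters_insertedRow_iff hQ hl]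
    cases s <;> rw [Side.insertedRow, skip_of_le (d := i) (by omega)]

theorem bump_or_exists_tileMatch (h : IsInsertion Q P c e) (hQ : Padded m Q) (k l : ℕ) :
    Q k l = Tile.bump ∨ ∃ i, TileMatch Q P c l k i := by
  rcases Nat.lt_or_ge l c with hl | hl
  · rcases Nat.lt_or_ge k (e (l + 1)) with hk | hk
    · exact Or.inr ⟨k, h.tileMatch_above hQ hl hk⟩
    · rcases h.step l hl with ⟨he, -⟩ | ⟨he, -, hbump⟩
      · exact Or.inr ⟨k + 1, h.tileMatch_below hQ hl (he ▸ hk)⟩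
      · rcases hk.eq_or_lt with rfl | hk
        · exact Or.inl hbump
        · exact Or.inr ⟨k + 1, h.tileMatch_below hQ hl (by omega)⟩
  · exact Or.inr ⟨k, h.tileMatch_right hQ hl k⟩

theorem entry_eq_bump_or_enters (h : IsInsertion Q P c e) (i : ℕ) :
    P i c = Tile.bump ∨ P i c = Tile.cross ∧ Enters P c Side.top i c := by
  rcases Nat.lt_or_ge i (e c) with hi | hi
  · exact Or.inr ⟨h.entry_cross hi, h.enters_entry hi.le⟩
  · exact Or.inl (h.entry_bump hi)

theorem bump_or_cross_or_exists_tileMatch (h : IsInsertion Q P c e) (hQ : Padded m Q) (i l : ℕ) :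
    P i (skip c l) = Tile.bump ∨
      (P i (skip c l) = Tile.cross ∧ Enters P c Side.right i (skip c l)) ∨
      ∃ k, TileMatch Q P c l k i := by
  rcases Nat.lt_or_ge l c with hl | hl
  · rcases Nat.lt_or_ge i (e (l + 1)) with hi | hi
    · exact Or.inr (Or.inr ⟨i, h.tileMatch_above hQ hl hi⟩)
    · rcases Nat.lt_or_ge (e l) i with hi' | hi'
      · obtain ⟨k, rfl⟩ := Nat.exists_eq_add_of_lt hi'
        exact Or.inr (Or.inr ⟨_, h.tileMatch_below hQ hl (by omega)⟩)
      · rw [skip_of_lt hl, h.enters_right_iff hl]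
        rcases h.step l hl with ⟨he, hcross, -⟩ | ⟨he, hP, hbump⟩
        · obtain rfl : i = e l := by omega
          exact Or.inr (Or.inl ⟨hcross, he⟩)
        · rcases hi'.lt_or_eq with hlt | rfl
          · obtain rfl : i = e (l + 1) := by omega
            exact Or.inl (by rw [h.above hl hlt, hbump])
          · exact Or.inl hP
  · exact Or.inr (Or.inr ⟨i, h.tileMatch_right hQ hl i⟩)

theorem exists_tileMatch_above (h : IsInsertion Q P c e) (hQ : Padded m Q)
    (hbump : Q k l = Tile.bump) (hcross : Q (k + 1) l = Tile.cross) :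
    ∃ i, TileMatch Q P c l (k + 1) (i + 1) ∧ P i (skip c l) = Tile.bump := by
  rcases Nat.lt_or_ge l c with hl | hl
  · have hle := h.exitRow_le hl
    rcases Nat.lt_or_ge (k + 1) (e (l + 1)) with hk | hk
    · refine ⟨k, h.tileMatch_above hQ hl hk, ?_⟩
      rw [skip_of_lt hl, h.above hl (by omega), hbump]
    · have hk' : e (l + 1) ≠ k + 1 := by
        intro heq
        rcases h.step l hl with ⟨he, -, hne⟩ | ⟨-, -, hbump'⟩
        · exact hne k (by omega) hbump
        · simp [heq, hcross] at hbump'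
      refine ⟨k + 1, h.tileMatch_below hQ hl (by omega), ?_⟩
      rw [skip_of_lt hl, h.below hl (by omega), hbump]
  · refine ⟨k, h.tileMatch_right hQ hl _, ?_⟩
    rw [skip_of_le hl, h.right k l hl, hbump]

theorem lt_or_lt_of_cross (h : IsInsertion Q P c e) (hj : j < c) (hbump : P i j = Tile.bump)
    (hcross : P (i + 1) j = Tile.cross) : i + 1 < e (j + 1) ∨ e (j + 1) < i ∧ e j ≤ i := by
  rcases h.step j hj with ⟨he, hx, hne⟩ | ⟨he, hP, hQ⟩
  · have hi : i ≠ e j := by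
      rintro rfl
      simp [hbump] at hx
    have hi' : i + 1 ≠ e j := fun heq => hne i heq (by rw [← h.above hj (by omega), hbump])
    omega
  · have hi : i + 1 ≠ e j := by
      intro heq
      simp [← heq, hcross] at hP
    have hi' : i + 1 ≠ e (j + 1) := by
      intro heq
      rw [← h.above hj (by omega), ← heq, hcross] at hQ
      cases hQ
    omega

theorem exists_tileMatch_of_cross (h : IsInsertion Q P c e) (hQ : Padded m Q)
    (hbump : P i j = Tile.bump) (hcross : P (i + 1) j = Tile.cross) :
    ∃ k l, j = skip c l ∧ TileMatch Q P c l (k + 1) (i + 1) ∧ Q k l = Tile.bump := by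
  rcases lt_trichotomy j c with hj | rfl | hj
  · have hskip : j = skip c j := (skip_of_lt hj).symm
    rcases h.lt_or_lt_of_cross hj hbump hcross with hi | ⟨hi, hi'⟩
    · refine ⟨i, j, hskip, h.tileMatch_above hQ hj hi, ?_⟩
      have := (h.exitRow_le hj).1
      rw [← h.above hj (by omega), hbump]
    · obtain ⟨k, rfl⟩ : ∃ k, i = k + 1 := ⟨i - 1, by omega⟩
      refine ⟨k, j, hskip, h.tileMatch_below hQ hj hi', ?_⟩
      rw [← h.below hj (by omega), hbump]
  · rcases Nat.lt_or_ge (i + 1) (e j) with hi | hi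
    · simp [h.entry_cross (Nat.lt_of_succ_lt hi)] at hbump
    · simp [h.entry_bump hi] at hcross
  · obtain ⟨l, rfl⟩ : ∃ l, j = l + 1 := ⟨j - 1, by omega⟩
    refine ⟨i, l, (skip_of_le (by omega)).symm, h.tileMatch_right hQ (by omega) _, ?_⟩
    rw [← h.right i l (by omega), hbump]

end IsInsertion

namespace TileMatch

variable {Q P : Filling} {c d i k l m : ℕ} {s : Side}

theorem traverses_iff (h : TileMatch Q P c l k i) :
    Traverses P (skip c d) i (skip c l) ↔ Traverses Q d k l :=
  or_congr h.enters_iff h.enters_iff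

theorem exists_enters (h : TileMatch Q P c l k i) (hQ : Padded m Q)
    (hd : Enters P d s i (skip c l)) : ∃ x, skip c x = d := by
  obtain ⟨x, hx⟩ := hQ.exists_enters s k l
  exact ⟨x, (h.enters_iff.2 hx).label_unique hd⟩

theorem not_traverses (h : TileMatch Q P c l k i) (hQ : Padded m Q) :
    ¬ Traverses P c i (skip c l) := by
  rintro (hd | hd) <;>
  · obtain ⟨x, hx⟩ := h.exists_enters hQ hd
    unfold skip at hx
    split_ifs at hx <;> omega

theorem validAt_iff (h : TileMatch Q P c l k i) (hQ : Padded m Q) :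
    ValidAt P i (skip c l) ↔ ValidAt Q k l := by
  constructor
  · intro hP x y hx hy
    simpa only [h.tile, skip_lt_skip] using hP _ _ (h.enters_iff.2 hx) (h.enters_iff.2 hy)
  · intro hvalid x y hx hy
    obtain ⟨x, rfl⟩ := h.exists_enters hQ hx
    obtain ⟨y, rfl⟩ := h.exists_enters hQ hy
    simpa only [h.tile, skip_lt_skip] using hvalid _ _ (h.enters_iff.1 hx) (h.enters_iff.1 hy)

end TileMatch

namespace IsInsertion

variable {Q P : Filling} {c d i m : ℕ} {e : ℕ → ℕ}

theorem removableCol (h : IsInsertion Q P c e) (hQ : Padded m Q) : RemovableCol P c where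
  entry_cross i hx := by
    rcases h.entry_eq_bump_or_enters i with hbump | ⟨-, htop⟩
    · simp [hbump] at hx
    · exact Or.inl htop
  entry_unmarked i := by
    rcases h.entry_eq_bump_or_enters i with hx | ⟨hx, -⟩ <;> simp [hx]
  above_cross i j hx htrav hbump := by
    obtain ⟨k, l, rfl, hkl, -⟩ := h.exists_tileMatch_of_cross hQ hbump hx
    exact hkl.not_traverses hQ htrav
  unmarked i j htrav hmarked := by
    rcases eq_or_ne j c with rfl | hj
    · rcases h.entry_eq_bump_or_enters i with hx | ⟨hx, -⟩ <;> simp [hx] at hmarked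
    · obtain ⟨l, rfl⟩ := exists_skip_of_ne hj
      rcases h.bump_or_cross_or_exists_tileMatch hQ i l with hx | ⟨hx, -⟩ | ⟨k, hkl⟩
      · simp [hx] at hmarked
      · simp [hx] at hmarked
      · exact hkl.not_traverses hQ htrav

theorem locallyValid_of_locallyValid (h : IsInsertion Q P c e) (hQ : Padded m Q)
    (hP : LocallyValid P) : LocallyValid Q := by
  intro k l
  rcases h.bump_or_exists_tileMatch hQ k l with hx | ⟨i, hkl⟩
  · simp [ValidAt, hx]
  · exact (hkl.validAt_iff hQ).1 (hP i (skip c l))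

theorem locallyValid (h : IsInsertion Q P c e) (hQ : Padded m Q) (hvalid : LocallyValid Q)
    (hcross : ∀ i j x, P i j = Tile.cross → Enters P c Side.right i j → Enters P x Side.top i j →
      x < c) : LocallyValid P := by
  intro i j
  rcases eq_or_ne j c with rfl | hj
  · intro x y hx hy
    rcases h.entry_eq_bump_or_enters i with hbump | ⟨hbump, htop⟩
    · simp [hbump]
    · simp only [hbump, forall_const, reduceCtorEq, false_implies, and_true]
      exact hx.label_unique htop ▸ hy.col_lt
  · obtain ⟨l, rfl⟩ := exists_skip_of_ne hj
    rcases h.bump_or_cross_or_exists_tileMatch hQ i l with hbump | ⟨hbump, hright⟩ | ⟨k, hkl⟩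
    · simp [ValidAt, hbump]
    · intro x y hx hy
      simp only [hbump, forall_const, reduceCtorEq, false_implies, and_true]
      obtain rfl := hy.label_unique hright
      exact hcross i _ x hbump hright hx
    · exact (hkl.validAt_iff hQ).2 (hvalid k l)

theorem removableCol_of_skip (h : IsInsertion Q P c e) (hQ : Padded m Q)
    (hP : RemovableCol P (skip c d)) : RemovableCol Q d where
  entry_cross i hx := by
    obtain hbump | ⟨_, hi⟩ := h.bump_or_exists_tileMatch hQ i d
    · simp [hbump] at hx
    · exact hi.traverses_iff.1 (hP.entry_cross _ (hi.tile.trans hx))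
  entry_unmarked i hx := by
    obtain hbump | ⟨_, hi⟩ := h.bump_or_exists_tileMatch hQ i d
    · simp [hbump] at hx
    · exact hP.entry_unmarked _ (hi.tile.trans hx)
  above_cross i j hx htrav hbump := by
    obtain ⟨_, hi, hbump'⟩ := h.exists_tileMatch_above hQ hbump hx
    exact hP.above_cross _ _ (hi.tile.trans hx) (hi.traverses_iff.2 htrav) hbump'
  unmarked i j htrav hx := by
    obtain hbump | ⟨_, hi⟩ := h.bump_or_exists_tileMatch hQ i j
    · simp [hbump] at hx
    · exact hP.unmarked _ _ (hi.traverses_iff.2 htrav) (hi.tile.trans hx)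

/-- If the inserted pipe has a crossing tile in column `d`, then the tiles of `Q` above it are
crossing tiles, because the one directly above is not an unmarked bumping tile. -/
theorem enters_top_of_cross_right (h : IsInsertion Q P c e) (hd : RemovableCol Q d)
    (hx : P i (skip c d) = Tile.cross) (hright : Enters P c Side.right i (skip c d)) :
    Enters P (skip c d) Side.top i (skip c d) := by
  have hdc : d < c := by
    have := hright.col_lt
    unfold skip at this
    split_ifs at this <;> omega
  rw [skip_of_lt hdc] at hx hright
  have hi := (h.enters_right_iff hdc).1 hright
  obtain ⟨he, hne⟩ : e d = e (d + 1) ∧ ∀ k, k + 1 = e d → Q k d ≠ Tile.bump := by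
    rcases h.step d hdc with ⟨he, -, hne⟩ | ⟨he, -, hbump⟩
    · exact ⟨he, hne⟩
    · rw [hi, h.above hdc (by omega), hbump] at hx
      cases hx
  cases i with
  | zero =>
    rw [skip_of_lt hdc]
    exact .start
  | succ k =>
    have hcross : Q k d = Tile.cross := by
      by_contra hcross
      exact hne k (by omega) (Tile.eq_bump hcross (hd.entry_unmarked k))
    have htop := h.enters_insertedRow (hd.entry_cross k hcross).enters_top hdc
    rw [Side.insertedRow, skip_of_lt (c := e d) (by omega)] at htop
    conv_rhs => rw [skip_of_lt hdc]
    exact htop.cross_down (by rw [h.above hdc (by omega), hcross])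

theorem removableCol_skip (h : IsInsertion Q P c e) (hQ : Padded m Q) (hd : RemovableCol Q d) :
    RemovableCol P (skip c d) where
  entry_cross i hx := by
    rcases h.bump_or_cross_or_exists_tileMatch hQ i d with hbump | ⟨-, hright⟩ | ⟨k, hk⟩
    · simp [hbump] at hx
    · exact Or.inl (h.enters_top_of_cross_right hd hx hright)
    · exact hk.traverses_iff.2 (hd.entry_cross k (hk.tile.symm.trans hx))
  entry_unmarked i hx := by
    rcases h.bump_or_cross_or_exists_tileMatch hQ i d with hbump | ⟨hcross, -⟩ | ⟨k, hk⟩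
    · simp [hbump] at hx
    · simp [hcross] at hx
    · exact hd.entry_unmarked k (hk.tile.symm.trans hx)
  above_cross i j hx htrav hbump := by
    obtain ⟨k, l, rfl, hk, hbump'⟩ := h.exists_tileMatch_of_cross hQ hbump hx
    exact hd.above_cross k l (hk.tile.symm.trans hx) (hk.traverses_iff.1 htrav) hbump'
  unmarked i j htrav hx := by
    rcases eq_or_ne j c with rfl | hj
    · rcases h.entry_eq_bump_or_enters i with hx' | ⟨hx', -⟩ <;> simp [hx'] at hx
    · obtain ⟨l, rfl⟩ := exists_skip_of_ne hj
      rcases h.bump_or_cross_or_exists_tileMatch hQ i l with hbump | ⟨hcross, -⟩ | ⟨k, hk⟩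
      · simp [hbump] at hx
      · simp [hcross] at hx
      · exact hd.unmarked k l (hk.traverses_iff.1 htrav) (hk.tile.symm.trans hx)

theorem removableCol_skip_iff (h : IsInsertion Q P c e) (hQ : Padded m Q) :
    RemovableCol P (skip c d) ↔ RemovableCol Q d :=
  ⟨h.removableCol_of_skip hQ, h.removableCol_skip hQ⟩

end IsInsertion

/-! ### Removable pipes are inserted pipes -/

section Deletion

variable {P : Filling} {c j m r r' : ℕ}

theorem Padded.exists_leavesLeft_of_col_le (hP : Padded m P) (hj : j ≤ c) :
    ∃ k, LeavesLeft P c k j := by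
  induction hj using Nat.decreasingInduction with
  | self =>
    obtain ⟨k, -, hk, -⟩ := hP.exists_leavesLeft_of_top (.start (c := c))
    exact ⟨k, hk⟩
  | of_succ j _ ih =>
    obtain ⟨r, hr⟩ := ih
    obtain ⟨k, -, hk, -⟩ := hP.exists_leavesLeft_of_right (enters_right_iff.2 hr)
    exact ⟨k, hk⟩

theorem RemovableCol.cross_or_bump (h : RemovableCol P c) (hr : LeavesLeft P c r (j + 1))
    (hr' : LeavesLeft P c r' j) :
    (r' = r ∧ P r j = Tile.cross) ∨
      (r' = r + 1 ∧ P r j = Tile.bump ∧ P (r + 1) j = Tile.bump) := by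
  have hright : Enters P c Side.right r j := enters_right_iff.2 hr
  by_cases hx : P r j = Tile.cross
  · exact Or.inl ⟨hr'.row_unique (Or.inr ⟨hright, hx⟩), hx⟩
  · have hbump := Tile.eq_bump hx (h.unmarked r j (Or.inr hright))
    have htop := hright.bump_down hx
    have hx' : P (r + 1) j ≠ Tile.cross := fun hx' => h.above_cross r j hx' (Or.inl htop) hbump
    exact Or.inr ⟨hr'.row_unique (Or.inl ⟨htop, hx'⟩), hbump,
      Tile.eq_bump hx' (h.unmarked _ _ (Or.inl htop))⟩

theorem RemovableCol.entry_eq (h : RemovableCol P c) (hr : LeavesLeft P c r c) (i : ℕ) :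
    P i c = if i < r then Tile.cross else Tile.bump := by
  obtain ⟨htop, hx⟩ := hr.resolve_right fun hr => hr.1.col_lt.false
  split_ifs with hi
  · exact htop.cross_above hi
  · refine Tile.eq_bump (fun hcross => hx ?_) (h.entry_unmarked i)
    rcases (not_lt.1 hi).eq_or_lt with rfl | hlt
    · exact hcross
    · exact (h.entry_cross i hcross).enters_top.cross_above hlt

theorem RemovableCol.exists_isInsertion (h : RemovableCol P c) (hP : Padded m P) :
    ∃ e, IsInsertion (deleteCol P c) P c e := by
  have hexists (j : ℕ) (hj : j ≤ c) : ∃ k, LeavesLeft P c k j := hP.exists_leavesLeft_of_col_le hj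
  choose! e he using hexists
  have hcases (j : ℕ) (hj : j < c) := h.cross_or_bump (he (j + 1) hj) (he j hj.le)
  have hdelete {i j : ℕ} (hj : j < c) := deleteCol_of_lt (i := i) hj (he (j + 1) hj)
  refine ⟨e, fun i j hj => (deleteCol_of_le hj).symm, h.entry_eq (he c le_rfl), fun i j hj => ?_,
    fun j hj => ?_⟩
  · rw [hdelete hj, skip]
    rcases hcases j hj with ⟨hej, hx⟩ | ⟨hej, hx, _⟩ <;> rw [hej] <;>
      split_ifs <;> grind
  · rcases hcases j hj with ⟨hej, hx⟩ | ⟨hej, hx, _⟩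
    · refine Or.inl ⟨hej, by rwa [hej], fun i hi => ?_⟩
      rw [hdelete hj, if_neg (by omega), if_neg (by omega)]
      rw [← hej, ← hi] at hx
      exact h.above_cross i j hx (Or.inr (enters_right_iff.2 (by rw [hi, hej]; exact he _ hj)))
    · exact Or.inr ⟨hej, by rwa [hej], by rw [hdelete hj, if_pos ⟨rfl, by simp [hx]⟩]⟩

end Deletion

section Insertion

variable {Q P : Filling} {c j m p : ℕ} {e : ℕ → ℕ}

open Classical in
/-- The row in which a pipe inserted into `Q` leaves column `j` if it leaves column `0` in
row `p`. -/
noncomputable def insertRow (Q : Filling) (p : ℕ) : ℕ → ℕ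
  | 0 => p
  | j + 1 =>
    let r := insertRow Q p j
    if 0 < r ∧ Q (r - 1) j = Tile.bump then r - 1 else r

theorem insertRow_succ (Q : Filling) (p j : ℕ) :
    (insertRow Q p j = insertRow Q p (j + 1) ∧
      ∀ i, i + 1 = insertRow Q p j → Q i j ≠ Tile.bump) ∨
    (insertRow Q p j = insertRow Q p (j + 1) + 1 ∧ Q (insertRow Q p (j + 1)) j = Tile.bump) := by
  rw [insertRow]
  split_ifs with h
  · exact Or.inr ⟨by omega, h.2⟩
  · refine Or.inl ⟨rfl, fun i hi hbump => h ⟨by omega, ?_⟩⟩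
    rwa [← hi]

/-- The filling that arises from `Q` by the insertion of a pipe that enters in column `c` and
leaves in row `p`. -/
noncomputable def insertPipe (Q : Filling) (c p : ℕ) : Filling := fun i j =>
  if c < j then Q i (j - 1)
  else if j = c then if i < insertRow Q p c then Tile.cross else Tile.bump
  else if i < insertRow Q p j then Q i j
  else if i = insertRow Q p (j + 1) then Tile.cross
  else Q (i - 1) j

theorem isInsertion_insertPipe (Q : Filling) (c p : ℕ) :
    IsInsertion Q (insertPipe Q c p) c (insertRow Q p) where
  right i j hj := by simp [insertPipe, Nat.lt_succ_of_le hj]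
  entry i := by simp [insertPipe]
  left i j hj := by
    unfold insertPipe skip
    rcases insertRow_succ Q p j with ⟨he, -⟩ | ⟨he, -⟩ <;> grind
  step j hj := by
    unfold insertPipe
    rcases insertRow_succ Q p j with ⟨he, hx⟩ | ⟨he, hx⟩
    · exact Or.inl ⟨he, by grind, hx⟩
    · exact Or.inr ⟨he, by grind, hx⟩

theorem IsInsertion.padded_of_succ (h : IsInsertion Q P c e) (hP : Padded (m + 1) P)
    (hc : c ≤ m) : Padded m Q := by
  intro i j hij
  rcases Nat.lt_or_ge j c with hj | hj
  · rcases Nat.lt_or_ge i (e (j + 1)) with hi | hi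
    · have := ((enters_right_iff.2 (h.leavesLeft hj)).add_lt hP (by omega)).2 rfl
      omega
    · rw [← h.below hj hi]
      exact hP _ _ (by omega)
  · rw [← h.right _ _ hj]
    exact hP _ _ (by omega)

theorem IsInsertion.exitRow_add_le (h : IsInsertion Q P c e) (hQ : Padded m Q) (h0 : e 0 ≤ m)
    (hc : c ≤ m) (hj : j ≤ c) : e j + j ≤ m := by
  induction j with
  | zero => omega
  | succ j ih =>
    have ih := ih (by omega)
    rcases h.step j hj with ⟨he, -, hne⟩ | ⟨he, -⟩
    · by_contra hlt
      exact hne (e j - 1) (by omega) (hQ _ _ (by omega))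
    · omega

theorem IsInsertion.padded (h : IsInsertion Q P c e) (hQ : Padded m Q) (h0 : e 0 ≤ m)
    (hc : c ≤ m) : Padded (m + 1) P := by
  intro i j hij
  rcases lt_trichotomy j c with hj | rfl | hj
  · have hle := h.exitRow_add_le (j := j + 1) hQ h0 hc hj
    have := h.exitRow_le hj
    have := h.exitRow_add_le hQ h0 hc hj.le
    rcases Nat.lt_or_ge i (e j) with hi | hi
    · rw [h.above hj hi]
      exact hQ _ _ (by omega)
    · rcases hi.eq_or_lt with rfl | hi
      · rcases h.step j hj with ⟨he, -⟩ | ⟨-, hbump, -⟩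
        · omega
        · exact hbump
      · obtain ⟨i, rfl⟩ := Nat.exists_eq_add_one_of_ne_zero (Nat.ne_zero_of_lt hi)
        rw [h.below hj (by omega)]
        exact hQ _ _ (by omega)
  · have := h.exitRow_add_le hQ h0 hc le_rfl
    exact h.entry_bump (by omega)
  · obtain ⟨l, rfl⟩ := Nat.exists_eq_add_one_of_ne_zero (Nat.ne_zero_of_lt hj)
    rw [h.right _ _ (by omega)]
    exact hQ _ _ (by omega)

end Insertion

/-! ### The pattern `1423` -/

section Pattern

variable {Q P : Filling} {c d f j k m x : ℕ} {e : ℕ → ℕ}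

theorem LeavesLeft.exists_exits_le (h : LeavesLeft P x k j) : ∃ y ≤ x, ∃ r ≤ k, Exits P y r := by
  induction j generalizing x k with
  | zero => exact ⟨x, le_rfl, k, le_rfl, h⟩
  | succ j ih =>
    have hright := enters_right_iff.2 h
    obtain ⟨y, hy, r, hr, hleft⟩ : ∃ y ≤ x, ∃ r ≤ k, LeavesLeft P y r j := by
      rcases enters_or_leavesLeft P k j with htop | ⟨r, hr, hleft⟩
      · by_cases hx : P k j = Tile.cross
        · exact ⟨x, le_rfl, k, le_rfl, Or.inr ⟨hright, hx⟩⟩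
        · exact ⟨j, hright.col_lt.le, k, le_rfl, Or.inl ⟨htop, hx⟩⟩
      · exact ⟨j, hright.col_lt.le, r, hr.le, hleft⟩
    obtain ⟨y', hy', r', hr', hexit⟩ := ih hleft
    exact ⟨y', by omega, r', by omega, hexit⟩

namespace IsInsertion

theorem label_ne (h : IsInsertion Q P c e) (hj : j ≤ c) (hd : LeavesLeft P d k j)
    (hk : k ≠ e j) : c ≠ d := by
  rintro rfl
  exact hk (hd.row_unique (h.leavesLeft hj))

theorem exists_exits_below (h : IsInsertion Q P c e) (hP : Padded m P) (hj : j ≤ c)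
    (hd : LeavesLeft P d k j) (hk : e j < k) : ∃ r, e 0 < r ∧ Exits P d r := by
  induction j generalizing k with
  | zero => exact ⟨k, hk, hd⟩
  | succ j ih =>
    obtain ⟨r, hkr, hleft, -⟩ := hP.exists_leavesLeft_of_right (enters_right_iff.2 hd)
    have hne : e j ≠ r := by
      rintro rfl
      exact h.label_ne hj hd hk.ne' ((h.leavesLeft (Nat.le_of_lt hj)).label_unique hleft)
    have := h.exitRow_le hj
    exact ih (by omega) hleft (by omega)

theorem exists_exits_above (h : IsInsertion Q P c e) (hP : Padded m P) (hj : j ≤ c)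
    (hf : LeavesLeft P f k j) (hk : k < e j)
    (hcross : ∀ l < j, e l = e (l + 1) → ¬ Enters P f Side.top (e l) l) :
    ∃ r, k ≤ r ∧ r < e 0 ∧ Exits P f r := by
  induction j generalizing k with
  | zero => exact ⟨k, le_rfl, hk, hf⟩
  | succ j ih =>
    obtain ⟨r, hkr, hleft, htop⟩ := hP.exists_leavesLeft_of_right (enters_right_iff.2 hf)
    have hr : r < e j := by
      by_contra! hle
      have := h.exitRow_le hj
      have hf' : Enters P f Side.top (e j) j := htop _ (by omega) hle
      rcases h.step j hj with ⟨he, -⟩ | ⟨-, hbump, -⟩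
      · exact hcross j (by omega) he hf'
      · have hc : Enters P c Side.top (e j) j := by
          simpa [LeavesLeft, hbump] using h.leavesLeft (Nat.le_of_lt hj)
        exact h.label_ne hj hf hk.ne (hc.label_unique hf')
    obtain ⟨r', hrr', hr', hexit⟩ :=
      ih (by omega) hleft hr fun l hl => hcross l (by omega)
    exact ⟨r', by omega, hr', hexit⟩

/-- The tile above a crossing tile of the inserted pipe is not an unmarked bumping tile, so that
the pipe `d` through the top of the crossing tile and the other pipe `f` of the tile above it are
ordered as in a crossing or a marked tile. -/
theorem exists_leavesLeft_above_cross (h : IsInsertion Q P c e) (hQ : Padded m Q)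
    (hP : Padded (m + 1) P) (hvalid : LocallyValid Q) (hj : j < c) (he : e j = e (j + 1))
    (hd : Enters P d Side.top (e j) j) (hcd : c < d) :
    ∃ f k, e j = k + 1 ∧ d < f ∧ LeavesLeft P f k j ∧ ¬ Enters P j Side.top k j := by
  obtain ⟨k, hk⟩ : ∃ k, e j = k + 1 := by
    refine Nat.exists_eq_succ_of_ne_zero fun h0 => ?_
    rw [h0] at hd
    cases hd
    omega
  have hvalidP : ValidAt P k j := by
    have hmatch := h.tileMatch_above hQ hj (i := k) (by omega)
    simpa only [skip_of_lt hj] using (hmatch.validAt_iff hQ).2 (hvalid k j)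
  have hne : P k j ≠ Tile.bump := by
    rw [h.above hj (by omega)]
    rcases h.step j hj with ⟨-, -, hne⟩ | ⟨he', -⟩
    · exact hne k hk.symm
    · omega
  rw [hk] at hd
  obtain ⟨f, hf⟩ := hP.exists_leavesLeft k j
  refine ⟨f, k, hk, ?_⟩
  cases hd with
  | cross_down hd hx =>
    have hf' := (hf.resolve_left fun hf => hf.2 hx).1
    exact ⟨(hvalidP _ _ hd hf').1 hx, hf, fun hj' => by have := hd.label_unique hj'; omega⟩
  | bump_down hd hx =>
    have hf' := (hf.resolve_right fun hf => hx hf.2).1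
    have hdf : d < f := (hvalidP _ _ hf' hd).2 (by_contra fun hm => hne (Tile.eq_bump hx hm))
    exact ⟨hdf, hf, fun hj' => by have := hf'.label_unique hj'; omega⟩

/-- The pipes `x, f, c, d` form the pattern `1423`. Here `d` comes from the leftmost crossing of the
forbidden kind; hence the inserted pipe does not cross `f` further to the left. -/
theorem exists_exits_of_cross (h : IsInsertion Q P c e) (hQ : Padded m Q)
    (hP : Padded (m + 1) P) (hvalid : LocallyValid Q)
    (hbad : ∃ j < c, e j = e (j + 1) ∧ ∃ d ≥ c, Enters P d Side.top (e j) j) :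
    ∃ x d f r₁ r₂ r₃, x < c ∧ c < d ∧ d < f ∧ d < m + 1 ∧ r₁ < r₂ ∧ r₂ < e 0 ∧
      e 0 < r₃ ∧ Exits P x r₁ ∧ Exits P f r₂ ∧ Exits P d r₃ := by
  classical
  obtain ⟨j, ⟨hj, he, d, hcd, hd⟩, hmin⟩ := Nat.findX hbad
  have hright : Enters P c Side.right (e j) j := (h.enters_right_iff hj).2 he
  replace hcd : c < d := lt_of_le_of_ne hcd (hd.top_ne_right hright).symm
  obtain ⟨f, k, hk, hdf, hf, hxj⟩ := h.exists_leavesLeft_above_cross hQ hP hvalid hj he hd hcd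
  obtain ⟨k₁, hk₁, hx⟩ := (enters_or_leavesLeft P k j).resolve_left hxj
  have hcross : P (e j) j = Tile.cross := by
    rcases h.step j hj with ⟨-, hcross, -⟩ | ⟨he', -⟩
    · exact hcross
    · omega
  obtain ⟨k₃, hk₃, hd', -⟩ := hP.exists_leavesLeft_of_top (hd.cross_down hcross)
  obtain ⟨x, hxj, r₁, hr₁, hexit₁⟩ := hx.exists_exits_le
  obtain ⟨r₂, hr₂, hr₂', hexit₂⟩ := h.exists_exits_above hP hj.le hf (by omega)
    fun l hl hel hfl => hmin l hl ⟨by omega, hel, f, by omega, hfl⟩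
  obtain ⟨r₃, hr₃, hexit₃⟩ := h.exists_exits_below hP hj.le hd' hk₃
  exact ⟨x, d, f, r₁, r₂, r₃, by omega, hcd, hdf, hd.lt_of_ne_bump hP (by simp [hcross]),
    by omega, hr₂', hr₃, hexit₁, hexit₂, hexit₃⟩

end IsInsertion

end Pattern

/-! ### Words -/

section Words

variable {v : List ℕ} {a b i : ℕ}

/-- The word `v` avoids the pattern `1423`; the version of `Avoids1423` for words. -/
def WordAvoids1423 (v : List ℕ) : Prop :=
  ∀ a b c d, [a, b, c, d].Sublist v → ¬ (a < c ∧ c < d ∧ d < b)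

theorem WordAvoids1423.sublist {u : List ℕ} (h : WordAvoids1423 v) (hu : u.Sublist v) :
    WordAvoids1423 u :=
  fun a b c d hs => h a b c d (hs.trans hu)

theorem WordAvoids1423.getElem {i j k l : ℕ} (h : WordAvoids1423 v) (hij : i < j) (hjk : j < k)
    (hkl : k < l) (hl : l < v.length) : ¬ (v[i] < v[k] ∧ v[k] < v[l] ∧ v[l] < v[j]) := by
  refine h _ _ _ _ ?_
  have := List.map_getElem_sublist (l := v)
    (is := [⟨i, by omega⟩, ⟨j, by omega⟩, ⟨k, by omega⟩, ⟨l, hl⟩]) (by simp; omega)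
  simpa using this

theorem Avoids1423.wordAvoids1423 {n : ℕ} {w : Equiv.Perm (Fin n)} (hw : Avoids1423 w) :
    WordAvoids1423 (oneLine w) := by
  intro a b c d hs hlt
  rw [oneLine, List.ofFn_eq_map, List.sublist_map_iff] at hs
  obtain ⟨l, hl, heq⟩ := hs
  obtain ⟨i, j, k, l, rfl⟩ : ∃ i j k m, l = [i, j, k, m] :=
    List.length_eq_four.1 (by simpa using congrArg List.length heq.symm)
  have hmono := (List.pairwise_lt_finRange n).sublist hl
  simp only [List.map_cons, List.cons.injEq] at heq
  obtain ⟨rfl, rfl, rfl, rfl, -⟩ := heq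
  have hij : i < j := List.rel_of_pairwise_cons hmono (by simp)
  have hjk : j < k := List.rel_of_pairwise_cons hmono.of_cons (by simp)
  have hkl : k < l := List.rel_of_pairwise_cons hmono.of_cons.of_cons (by simp)
  exact hw ⟨i, j, k, l, hij, hjk, hkl, by simpa using hlt⟩

theorem nodup_oneLine {n : ℕ} (w : Equiv.Perm (Fin n)) : (oneLine w).Nodup :=
  List.nodup_ofFn.2 fun _ _ h => w.injective (Fin.ext (by simpa using h))

theorem entryCol_eq_erase_add (ha : a ∈ v) (b : ℕ) :
    entryCol v b = entryCol (v.erase a) b + if a < b then 1 else 0 := by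
  unfold entryCol
  rw [(List.perm_cons_erase ha).countP_eq, List.countP_cons]
  simp

theorem entryCol_mono (v : List ℕ) : Monotone (entryCol v) := by
  refine fun a b h => List.countP_mono_left fun x _ hx => ?_
  simp only [decide_eq_true_eq] at hx ⊢
  omega

theorem entryCol_lt_entryCol_iff (ha : a ∈ v) : entryCol v a < entryCol v b ↔ a < b := by
  refine ⟨fun h => (entryCol_mono v).reflect_lt h, fun h => ?_⟩
  rw [entryCol_eq_erase_add ha, entryCol_eq_erase_add ha, if_neg (lt_irrefl a), if_pos h]
  exact Nat.lt_succ_of_le (entryCol_mono _ h.le)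

theorem entryCol_injOn (v : List ℕ) : Set.InjOn (entryCol v) {a | a ∈ v} := by
  intro a ha b hb h
  have hab := (entryCol_lt_entryCol_iff (b := b) ha).not.1 h.not_lt
  have hba := (entryCol_lt_entryCol_iff (b := a) hb).not.1 h.not_gt
  omega

theorem entryCol_le_length_erase (ha : a ∈ v) : entryCol v a ≤ (v.erase a).length := by
  rw [entryCol_eq_erase_add ha, if_neg (lt_irrefl a)]
  exact List.countP_le_length

theorem entryCol_lt_length (ha : a ∈ v) : entryCol v a < v.length := by
  rw [← List.length_erase_add_one ha]
  exact Nat.lt_succ_of_le (entryCol_le_length_erase ha)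

theorem entryCol_eq_skip (ha : a ∈ v) (hb : b ∈ v) (hne : b ≠ a) :
    entryCol v b = skip (entryCol v a) (entryCol (v.erase a) b) := by
  have hb' : b ∈ v.erase a := (List.mem_erase_of_ne hne).2 hb
  rw [entryCol_eq_erase_add ha b, entryCol_eq_erase_add ha a, if_neg (lt_irrefl a), add_zero]
  rcases hne.lt_or_gt with h | h
  · rw [skip_of_lt ((entryCol_lt_entryCol_iff hb').2 h), if_neg h.not_gt, add_zero]
  · rw [skip_of_le (entryCol_mono _ h.le), if_pos h]

theorem getElem_erase (hi : i < (v.erase a).length) (hi' : skip (v.idxOf a) i < v.length) :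
    (v.erase a)[i] = v[skip (v.idxOf a) i] := by
  simp only [List.erase_eq_eraseIdx_of_idxOf (i := v.idxOf a) rfl, List.getElem_eraseIdx]
  unfold skip
  split_ifs <;> rfl

theorem skip_idxOf_lt_length (ha : a ∈ v) :
    skip (v.idxOf a) i < v.length ↔ i < (v.erase a).length := by
  have := List.idxOf_lt_length_of_mem ha
  rw [List.length_erase_of_mem ha]
  unfold skip
  split_ifs <;> omega

end Words

section WordInsertion

variable {v : List ℕ} {Q P : Filling} {a i m r : ℕ} {e : ℕ → ℕ}

theorem IsInsertion.exits_entryCol_iff (h : IsInsertion Q P (entryCol v a) e) (hQ : Padded m Q)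
    (hv : v.Nodup) (ha : a ∈ v) (h0 : e 0 = v.idxOf a) (hi : i < (v.erase a).length)
    (hi' : skip (v.idxOf a) i < v.length) :
    Exits P (entryCol v v[skip (v.idxOf a) i]) (skip (v.idxOf a) i) ↔
      Exits Q (entryCol (v.erase a) (v.erase a)[i]) i := by
  have hne : (v.erase a)[i] ≠ a := (hv.mem_erase_iff.1 (List.getElem_mem hi)).1
  rw [← getElem_erase hi hi', entryCol_eq_skip ha (List.mem_of_mem_erase (List.getElem_mem hi)) hne,
    ← h0, h.exits_iff hQ]

theorem IsInsertion.hasWord_iff (h : IsInsertion Q P (entryCol v a) e) (hQ : Padded m Q)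
    (hv : v.Nodup) (ha : a ∈ v) (h0 : e 0 = v.idxOf a) :
    HasWord v P ↔ HasWord (v.erase a) Q := by
  refine ⟨fun hP i hi => ?_, fun hword i hi => ?_⟩
  · have hi' := (skip_idxOf_lt_length ha).2 hi
    exact (h.exits_entryCol_iff hQ hv ha h0 hi hi').1 (hP _ hi')
  · by_cases hp : i = v.idxOf a
    · subst hp
      rw [List.getElem_idxOf, ← h0]
      exact h.leavesLeft (Nat.zero_le _)
    · obtain ⟨k, rfl⟩ := exists_skip_of_ne hp
      have hk := (skip_idxOf_lt_length ha).1 hi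
      exact (h.exits_entryCol_iff hQ hv ha h0 hk hi).2 (hword k hk)

theorem HasWord.eq_of_exits (h : HasWord v P) (ha : a ∈ v) (hr : r < v.length)
    (hexit : Exits P (entryCol v a) r) : v[r] = a :=
  entryCol_injOn v (List.getElem_mem hr) ha (LeavesLeft.label_unique (h r hr) hexit)

end WordInsertion

/-! ### Deletion of several pipes -/

section Deletions

variable {v : List ℕ} {Q P P' : Filling} {a b : ℕ} {e : ℕ → ℕ} {l : List ℕ}

theorem IsMRPD.exitRow_eq_idxOf (hP : IsMRPD v P) (hv : v.Nodup) (ha : a ∈ v)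
    (h : IsInsertion Q P (entryCol v a) e) : e 0 = v.idxOf a := by
  have hexit : Exits P (entryCol v a) (e 0) := h.leavesLeft (Nat.zero_le _)
  have hlt : e 0 < v.length :=
    LeavesLeft.row_lt hP.staircase hexit (entryCol_lt_length ha)
  have hword : HasWord v P := hP.word
  rw [← hv.idxOf_getElem _ hlt, hword.eq_of_exits ha hlt hexit]

theorem Removable.exists_isInsertion (ha : Removable v P a) (hP : IsMRPD v P) :
    ∃ e, IsInsertion (deleteCol P (entryCol v a)) P (entryCol v a) e :=
  ha.2.exists_isInsertion (m := v.length) hP.staircase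

theorem Removable.padded_deleteCol (ha : Removable v P a) (hP : IsMRPD v P) :
    Padded (v.erase a).length (deleteCol P (entryCol v a)) := by
  obtain ⟨e, h⟩ := ha.exists_isInsertion hP
  refine h.padded_of_succ ?_ (entryCol_le_length_erase ha.1)
  rw [List.length_erase_add_one ha.1]
  exact hP.staircase

theorem Removable.isMRPD_deleteCol (ha : Removable v P a) (hv : v.Nodup) (hP : IsMRPD v P) :
    IsMRPD (v.erase a) (deleteCol P (entryCol v a)) := by
  obtain ⟨e, h⟩ := ha.exists_isInsertion hP
  have hpad := ha.padded_deleteCol hP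
  obtain ⟨-, hvalid, hword⟩ := isMRPD_iff.1 hP
  exact isMRPD_iff.2 ⟨hpad, h.locallyValid_of_locallyValid hpad hvalid,
    (h.hasWord_iff hpad hv ha.1 (hP.exitRow_eq_idxOf hv ha.1 h)).1 hword⟩

theorem IsInsertion.removable_iff {m : ℕ} (h : IsInsertion Q P (entryCol v a) e)
    (hQ : Padded m Q) (ha : a ∈ v) (hne : b ≠ a) :
    Removable (v.erase a) Q b ↔ Removable v P b := by
  unfold Removable
  rw [List.mem_erase_of_ne hne]
  refine and_congr_right fun hb => ?_
  rw [entryCol_eq_skip ha hb hne, h.removableCol_skip_iff hQ]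

theorem Removable.removable_deleteCol_iff (ha : Removable v P a) (hP : IsMRPD v P) (hne : b ≠ a) :
    Removable (v.erase a) (deleteCol P (entryCol v a)) b ↔ Removable v P b := by
  obtain ⟨e, h⟩ := ha.exists_isInsertion hP
  exact h.removable_iff (ha.padded_deleteCol hP) ha.1 hne

theorem Removable.eq_of_deleteCol_eq (ha : Removable v P a) (ha' : Removable v P' a)
    (hv : v.Nodup) (hP : IsMRPD v P) (hP' : IsMRPD v P')
    (heq : deleteCol P (entryCol v a) = deleteCol P' (entryCol v a)) : P = P' := by
  obtain ⟨e, h⟩ := ha.exists_isInsertion hP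
  obtain ⟨e', h'⟩ := ha'.exists_isInsertion hP'
  rw [← heq] at h'
  exact h.unique h'
    ((hP.exitRow_eq_idxOf hv ha.1 h).trans (hP'.exitRow_eq_idxOf hv ha.1 h').symm)

theorem IsInsertion.lt_of_wordAvoids1423 (h : IsInsertion Q P (entryCol v a) e)
    (hpat : WordAvoids1423 v) (ha : a ∈ v) (hQ : Padded (v.erase a).length Q)
    (hP : Padded v.length P) (hvalid : LocallyValid Q) (hword : HasWord v P)
    (h0 : e 0 = v.idxOf a) {i j x : ℕ} (hx : P i j = Tile.cross)
    (hright : Enters P (entryCol v a) Side.right i j) (htop : Enters P x Side.top i j) :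
    x < entryCol v a := by
  by_contra! hle
  have hj := hright.col_lt
  obtain rfl := (h.enters_right_iff hj).1 hright
  have he : e j = e (j + 1) := by
    rcases h.step j hj with ⟨he, -⟩ | ⟨he, -, hbump⟩
    · exact he
    · rw [h.above hj (by omega), hbump] at hx
      cases hx
  obtain ⟨x, d, f, r₁, r₂, r₃, hxc, hcd, hdf, hdlt, hr₁₂, hr₂, hr₃, hex, hef, hed⟩ :=
    h.exists_exits_of_cross hQ (by rwa [List.length_erase_add_one ha]) hvalid
      ⟨j, hj, he, x, hle, he ▸ htop⟩
  rw [List.length_erase_add_one ha] at hdlt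
  have hr₃lt : r₃ < v.length := LeavesLeft.row_lt hP hed hdlt
  rw [h0] at hr₂ hr₃
  refine hpat.getElem hr₁₂ hr₂ hr₃ hr₃lt ?_
  simp only [← entryCol_lt_entryCol_iff (List.getElem_mem _)]
  rw [List.getElem_idxOf, LeavesLeft.label_unique (hword r₁ _) hex,
    LeavesLeft.label_unique (hword r₂ _) hef, LeavesLeft.label_unique (hword r₃ _) hed]
  exact ⟨hxc, hcd, hdf⟩

theorem exists_deleteCol_eq (hv : v.Nodup) (hpat : WordAvoids1423 v) (ha : a ∈ v)
    (hQ : IsMRPD (v.erase a) Q) :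
    ∃ P, IsMRPD v P ∧ Removable v P a ∧ deleteCol P (entryCol v a) = Q := by
  obtain ⟨hpad, hvalid, hword⟩ := isMRPD_iff.1 hQ
  have h := isInsertion_insertPipe Q (entryCol v a) (v.idxOf a)
  have h0 : insertRow Q (v.idxOf a) 0 = v.idxOf a := rfl
  have hP : Padded v.length (insertPipe Q (entryCol v a) (v.idxOf a)) := by
    rw [← List.length_erase_add_one ha]
    refine h.padded hpad ?_ (entryCol_le_length_erase ha)
    rw [h0, ← Nat.lt_add_one_iff, List.length_erase_add_one ha]
    exact List.idxOf_lt_length_of_mem ha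
  have hwordP := (h.hasWord_iff hpad hv ha h0).2 hword
  exact ⟨_, isMRPD_iff.2 ⟨hP, h.locallyValid hpad hvalid fun i j x =>
    h.lt_of_wordAvoids1423 hpat ha hpad hP hvalid hwordP h0, hwordP⟩,
    ⟨ha, h.removableCol hpad⟩, h.deleteCol_eq⟩

theorem fst_foldl_deletePipe (l v : List ℕ) (P : Filling) :
    (l.foldl deletePipe (v, P)).1 = v.diff l := by
  induction l generalizing v P with
  | nil => rfl
  | cons a l ih => rw [List.diff_cons, List.foldl_cons, deletePipe, ih]

theorem Removable.forall_removable_deleteCol (ha : Removable v P a) (hP : IsMRPD v P)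
    (hal : a ∉ l) (hr : ∀ b ∈ l, Removable v P b) :
    ∀ b ∈ l, Removable (v.erase a) (deleteCol P (entryCol v a)) b :=
  fun b hb => (ha.removable_deleteCol_iff hP (ne_of_mem_of_not_mem hb hal)).2 (hr b hb)

theorem isMRPD_foldl_deletePipe (hl : l.Nodup) (hv : v.Nodup) (hP : IsMRPD v P)
    (hr : ∀ a ∈ l, Removable v P a) : IsMRPD (v.diff l) (l.foldl deletePipe (v, P)).2 := by
  induction l generalizing v P with
  | nil => exact hP
  | cons a l ih =>
    obtain ⟨hal, hl⟩ := List.nodup_cons.1 hl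
    obtain ⟨ha, hr⟩ := List.forall_mem_cons.1 hr
    rw [List.diff_cons]
    exact ih hl (hv.erase a) (ha.isMRPD_deleteCol hv hP) (ha.forall_removable_deleteCol hP hal hr)

theorem removable_foldl_deletePipe_iff (hl : l.Nodup) (hv : v.Nodup) (hP : IsMRPD v P)
    (hr : ∀ a ∈ l, Removable v P a) (hb : b ∉ l) :
    Removable (v.diff l) (l.foldl deletePipe (v, P)).2 b ↔ Removable v P b := by
  induction l generalizing v P with
  | nil => rfl
  | cons a l ih =>
    obtain ⟨hal, hl⟩ := List.nodup_cons.1 hl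
    obtain ⟨ha, hr⟩ := List.forall_mem_cons.1 hr
    obtain ⟨hba, hb⟩ := List.ne_and_not_mem_of_not_mem_cons hb
    rw [List.diff_cons, ← ha.removable_deleteCol_iff hP hba]
    exact ih hl (hv.erase a) (ha.isMRPD_deleteCol hv hP) (ha.forall_removable_deleteCol hP hal hr)
      hb

theorem eq_of_foldl_deletePipe_eq (hl : l.Nodup) (hv : v.Nodup) (hP : IsMRPD v P)
    (hP' : IsMRPD v P') (hr : ∀ a ∈ l, Removable v P a) (hr' : ∀ a ∈ l, Removable v P' a)
    (heq : l.foldl deletePipe (v, P) = l.foldl deletePipe (v, P')) : P = P' := by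
  induction l generalizing v P P' with
  | nil => exact congrArg Prod.snd heq
  | cons a l ih =>
    obtain ⟨hal, hl⟩ := List.nodup_cons.1 hl
    obtain ⟨ha, hr⟩ := List.forall_mem_cons.1 hr
    obtain ⟨ha', hr'⟩ := List.forall_mem_cons.1 hr'
    exact ha.eq_of_deleteCol_eq ha' hv hP hP' <|
      ih hl (hv.erase a) (ha.isMRPD_deleteCol hv hP) (ha'.isMRPD_deleteCol hv hP')
        (ha.forall_removable_deleteCol hP hal hr) (ha'.forall_removable_deleteCol hP' hal hr') heq

theorem exists_foldl_deletePipe_eq (hl : l.Nodup) (hv : v.Nodup) (hpat : WordAvoids1423 v)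
    (hlv : l ⊆ v) (hQ : IsMRPD (v.diff l) Q) :
    ∃ P, IsMRPD v P ∧ (∀ a ∈ l, Removable v P a) ∧ l.foldl deletePipe (v, P) = (v.diff l, Q) := by
  induction l generalizing v with
  | nil => exact ⟨Q, hQ, List.forall_mem_nil _, rfl⟩
  | cons a l ih =>
    obtain ⟨hal, hl⟩ := List.nodup_cons.1 hl
    obtain ⟨hav, hlv⟩ := List.cons_subset.1 hlv
    have hlv' : l ⊆ v.erase a := fun b hb =>
      (List.mem_erase_of_ne (ne_of_mem_of_not_mem hb hal)).2 (hlv hb)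
    rw [List.diff_cons] at hQ ⊢
    obtain ⟨R, hR, hr, hfold⟩ := ih hl (hv.erase a) (hpat.sublist List.erase_sublist) hlv' hQ
    obtain ⟨P, hP, ha, rfl⟩ := exists_deleteCol_eq hv hpat hav hR
    refine ⟨P, hP, List.forall_mem_cons.2 ⟨ha, fun b hb => ?_⟩, hfold⟩
    exact (ha.removable_deleteCol_iff hP (ne_of_mem_of_not_mem hb hal)).1 (hr b hb)

end Deletions

/-! ### The reduction map -/

section Reduction

variable {order u v : List ℕ} {P : Filling} {a : ℕ}

open Classical in
/-- The labels of the removable pipes of `P`, in the order in which `reduction` deletes them. -/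
noncomputable def removableLabels (order u : List ℕ) (P : Filling) : List ℕ :=
  order.filter (fun a => decide (Removable u P a))

theorem reduction_eq_foldl (order u : List ℕ) (P : Filling) :
    reduction order u P = (removableLabels order u P).foldl deletePipe (u, P) :=
  rfl

theorem mem_removableLabels (horder : order.Perm u) :
    a ∈ removableLabels order u P ↔ Removable u P a := by
  simp only [removableLabels, List.mem_filter, decide_eq_true_eq, and_iff_right_iff_imp]
  exact fun h => horder.mem_iff.2 h.1

theorem nodup_removableLabels (hu : u.Nodup) (horder : order.Perm u) :
    (removableLabels order u P).Nodup :=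
  (horder.nodup_iff.2 hu).filter _

theorem diff_filter_notMem (hu : u.Nodup) (h : v.Sublist u) (horder : order.Perm u) :
    u.diff (order.filter fun a => decide (a ∉ v)) = v := by
  have hsub : v.Sublist (u.diff (order.filter fun a => decide (a ∉ v))) := by
    rw [hu.sdiff_eq_filter]
    have := h.filter fun x => decide (x ∉ order.filter fun a => decide (a ∉ v))
    rwa [List.filter_eq_self.2 fun a ha => by simp [ha]] at this
  refine (hsub.eq_of_length_le ?_).symm
  refine (List.Nodup.subperm (hu.sublist (List.diff_sublist _ _)) fun x hx => ?_).length_le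
  rw [hu.mem_sdiff_iff] at hx
  by_contra hxv
  exact hx.2 (List.mem_filter.2 ⟨horder.mem_iff.2 hx.1, by simpa using hxv⟩)

theorem mapsTo_reduction (hu : u.Nodup) (horder : order.Perm u) :
    Set.MapsTo (reduction order u) (MRPD u) {D | D.1.Sublist u ∧ D.2 ∈ CMRPD D.1} := by
  intro P hP
  have hnd := nodup_removableLabels (P := P) hu horder
  have hr : ∀ a ∈ removableLabels order u P, Removable u P a := fun a =>
    (mem_removableLabels horder).1
  simp only [Set.mem_ofPred_eq, reduction_eq_foldl, fst_foldl_deletePipe]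
  refine ⟨List.diff_sublist _ _, isMRPD_foldl_deletePipe hnd hu hP hr, fun b hb => ?_⟩
  have hbl : b ∉ removableLabels order u P := (hu.mem_sdiff_iff.1 hb.1).2
  rw [removable_foldl_deletePipe_iff hnd hu hP hr hbl, ← mem_removableLabels horder] at hb
  exact hbl hb

/-- The labels that are missing in the word of the image tell which pipes were removable. -/
theorem injOn_reduction (hu : u.Nodup) (horder : order.Perm u) :
    Set.InjOn (reduction order u) (MRPD u) := by
  intro P hP P' hP' heq
  rw [reduction_eq_foldl, reduction_eq_foldl] at heq
  have hdiff := congrArg Prod.fst heq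
  rw [fst_foldl_deletePipe, fst_foldl_deletePipe] at hdiff
  have hrem : ∀ a, Removable u P a ↔ Removable u P' a := by
    intro a
    have hmem : a ∈ u → (¬ Removable u P a ↔ ¬ Removable u P' a) := fun ha => by
      rw [← mem_removableLabels horder, ← mem_removableLabels horder]
      simpa only [hu.mem_sdiff_iff, ha, true_and] using (congrArg (a ∈ ·) hdiff).to_iff
    exact ⟨fun h => not_imp_not.1 (hmem h.1).2 h, fun h => not_imp_not.1 (hmem h.1).1 h⟩
  have hlabels : removableLabels order u P = removableLabels order u P' :=
    List.filter_congr fun a _ => decide_eq_decide.2 (hrem a)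
  rw [← hlabels] at heq
  refine eq_of_foldl_deletePipe_eq (nodup_removableLabels hu horder) hu hP hP'
    (fun a => (mem_removableLabels horder).1) (fun a ha => ?_) heq
  exact (hrem a).1 ((mem_removableLabels horder).1 ha)

theorem surjOn_reduction (hu : u.Nodup) (hpat : WordAvoids1423 u) (horder : order.Perm u) :
    Set.SurjOn (reduction order u) (MRPD u) {D | D.1.Sublist u ∧ D.2 ∈ CMRPD D.1} := by
  rintro ⟨v, Q⟩ ⟨hv, hQ, hcore⟩
  set l := order.filter (fun a => decide (a ∉ v)) with hl
  have hdiff : u.diff l = v := diff_filter_notMem hu hv horder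
  have hnd : l.Nodup := (horder.nodup_iff.2 hu).filter _
  have hlu : l ⊆ u := fun a ha => horder.mem_iff.1 (List.mem_of_mem_filter ha)
  obtain ⟨P, hP, hr, hfold⟩ := exists_foldl_deletePipe_eq hnd hu hpat hlu (Q := Q) (by rwa [hdiff])
  have hlabels : removableLabels order u P = l := by
    refine List.filter_congr fun a ha => decide_eq_decide.2
      ⟨fun hra hav => hcore a ?_, fun hav => ?_⟩
    · have hal : a ∉ l := by simp [hl, hav]
      rw [← removable_foldl_deletePipe_iff hnd hu hP hr hal, hfold, hdiff] at hra
      exact hra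
    · exact hr a (by simp [hl, ha, hav])
  exact ⟨P, hP, by rw [reduction_eq_foldl, hlabels, hfold, hdiff]⟩

theorem theorem3p6_general (hu : u.Nodup) (hpat : WordAvoids1423 u) (horder : order.Perm u) :
    Set.BijOn (reduction order u) (MRPD u) {D | D.1.Sublist u ∧ D.2 ∈ CMRPD D.1} :=
  ⟨mapsTo_reduction hu horder, injOn_reduction hu horder, surjOn_reduction hu hpat horder⟩

end Reduction

end PipeDream

theorem theorem3p6 (n : ℕ) (w : Equiv.Perm (Fin n)) (hw : PipeDream.Avoids1423 w)
    (order : List ℕ) (horder : order.Perm (PipeDream.oneLine w)) :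
    Set.BijOn (fun P => PipeDream.reduction order (PipeDream.oneLine w) P)
      (PipeDream.MRPD (PipeDream.oneLine w)) (PipeDream.coresOfSubwords w) :=
  PipeDream.theorem3p6_general (PipeDream.nodup_oneLine w) hw.wordAvoids1423 horder
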